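/- **Setting.** Let $X\subset\mathbb R^d$ (states) and $U\subset\mathbb R^m$ (controls) be measurable sets of positive finite volume such that every ball around a point of $U$ meets $U$ in positive volume. Let $X_{\rm free}\subset X$ be the collision-free region, $\mathcal G\subset X$ the goal region, $x_{\rm start}$ the start state, $\mathcal T_p>0$ the maximal propagation time, $f$ the dynamics, $\ell\ge 0$ the running cost, $\phi\ge 0$ the terminal cost. Assume that $f$ and $\ell$ are Lipschitz in $x\in X$ and in $u\in U$ (Euclidean norms), and that $\phi$ is Lipschitz on $\mathcal G$. A *solution* $(\boldsymbol x,\boldsymbol u)$ is a continuous $x:[0,T]\to X_{\rm free}$ with $x(0)=x_{\rm start}$, $x(T)\in\mathcal G$, $\dot x=f(x,u)$, where $\boldsymbol u$ is a concatenation of finitely many (at least one) constant controls in $U$ with positive durations. Its cost is $\mathcal C_T(\boldsymbol x,\boldsymbol u)=\int_0^T\ell(x,u)\,dt+\phi(x(T))$. A solution is *robust* if all durations are positive integer multiples of one $\tau>0$ and if for some $\delta>0$ the closed balls of $\mathbb R^d$ of radius $\delta$ around all $x(t)$ lie in $X_{\rm free}$ and the one around $x(T)$ lies in $\mathcal G$.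 Let $c^*$ be the infimum of the costs of the robust solutions. **Algorithm (KiTe, AO-RRT with terminal cost).** The tree consists of vertices $(x,c)$ (state, accumulated running cost) and starts with $(x_{\rm start},0)$; $c_{\rm best}=+\infty$. In each iteration draw, independently and uniformly, $x_{\rm rand}\in X$, $\tau_{\rm rand}\in(0,\mathcal T_p]$, $u_{\rm rand}\in U$. If no solution has been found, take a vertex nearest to $x_{\rm rand}$ in state distance; otherwise draw $c_{\rm rand}$ uniformly from $(0,c_{\rm best})$ and take a vertex nearest to $(x_{\rm rand},c_{\rm rand})$ in $\mathbb R^d\times\mathbb R$ (ties broken by any rule for which $c_{\rm best}$ is a random variable determined by the past). Propagate it with constant control $u_{\rm rand}$ for time $\tau_{\rm rand}$ to $(x_{\rm new},c_{\rm new})$. Discard the result if the motion leaves $X_{\rm free}$, or if $c_{\rm new}+\mathcal H(x_{\rm new})\ge c_{\rm best}$, where the heuristic $\mathcal H$ is admissible (never larger than the total cost of a motion from the given state to the goal). Otherwise add the vertex; if $x_{\rm new}\in\mathcal G$ and $c_{\rm new}+\phi(x_{\rm new})<c_{\rm best}$, then this number becomes $c_{\rm best}$, the path to the new vertex becomes the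 best solution, and all vertices with $c>c_{\rm best}$ are removed. Let $(\boldsymbol x_n,\boldsymbol u_n)$ be the best solution after $n$ iterations and $C_n$ the value of $c_{\rm best}$. **Theorem.** 0. Almost surely, whenever a solution has been found, $(\boldsymbol x_n,\boldsymbol u_n)$ is a solution in the above sense, and $C_n=\mathcal C_T(\boldsymbol x_n,\boldsymbol u_n)$; before that $C_n=+\infty$. 1. Let $(\boldsymbol x_\delta,\boldsymbol u_\delta)$ be robust with $\mathcal C_T(\boldsymbol x_\delta,\boldsymbol u_\delta)>0$ and let $\varepsilon\in(0,1)$. For every $M$ there are $a,b>0$ and $n_0$ such that for all $n>n_0$ $$\Pr\big(C_n>(1+\varepsilon)\,\mathcal C_T(\boldsymbol x_\delta,\boldsymbol u_\delta)\ \text{ and }\ C_k\in[0,M]\cup\{+\infty\}\ \text{for all } k\le n\big)\le a\,e^{-bn}.$$ If the costs of all solutions are bounded (so that the sampled part of the augmented space $X\times\mathbb R_+$ has finite volume), then there are $a,b>0$ and $n_0$ such that for all $n>n_0$ $$\Pr\big(C_n>(1+\varepsilon)\,\mathcal C_T(\boldsymbol x_\delta,\boldsymbol u_\delta)\big)\le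 a\,e^{-bn}.$$ 2. Suppose that a robust solution exists. Then almost surely $\limsup_n C_n\le c^*$. If moreover $X_{\rm free}$ and $\mathcal G$ are open, or if no solution costs less than $c^*$, then $\Pr\big(\lim_{n\to\infty}C_n=c^*\big)=1$. (Part 2 needs neither bounded nor positive costs.) -/

import Mathlib

open MeasureTheory ProbabilityTheory Set Filter Topology

noncomputable section

namespace KiTe

/-- States: `ℝ^d` with the Euclidean norm. -/
abbrev Pt (d : ℕ) : Type := EuclideanSpace ℝ (Fin d)

/-- The data of an optimal kinodynamic planning problem and of the planner: state space `X`,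
collision-free part `Xfree` (the obstacles are `X \ Xfree`), control space `U`, dynamics `f`,
running cost `run`, terminal cost `term`, start state, goal region, maximal duration `Tp` of one
propagation, and heuristic `heur`. -/
structure Problem (d m : ℕ) where
  X : Set (Pt d)
  Xfree : Set (Pt d)
  U : Set (Pt m)
  f : Pt d → Pt m → Pt d
  run : Pt d → Pt m → ℝ
  term : Pt d → ℝ
  start : Pt d
  goal : Set (Pt d)
  Tp : ℝ
  heur : Pt d → ℝ

/-- A concatenation of constant control segments: the list of the pairs (control, duration). -/
abbrev Segs (m : ℕ) : Type := List (Pt m × ℝ)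

variable {d m : ℕ}

/-- The total duration of a concatenation. -/
def duration (p : Segs m) : ℝ := (p.map Prod.snd).sum

/-- The control function `t ↦ u(t)` of a concatenation; its values outside `[0, duration p)` are
irrelevant. -/
def inputAt : Segs m → ℝ → Pt m
  | [], _ => 0
  | s :: p, t => if t < s.2 then s.1 else inputAt p (t - s.2)

namespace Problem

variable (P : Problem d m)

/-- The segments use controls in `U` and have positive durations. -/
def StepControl (p : Segs m) : Prop := ∀ s ∈ p, s.1 ∈ P.U ∧ 0 < s.2

/-- Piecewise-constant control with resolution `τ`: controls in `U`, durations `k_i * τ`, where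
`k_i` is a positive integer. -/
def PiecewiseConstant (τ : ℝ) (p : Segs m) : Prop :=
  0 < τ ∧ ∀ s ∈ p, s.1 ∈ P.U ∧ ∃ k : ℕ, 0 < k ∧ s.2 = k * τ

/-- On `[0, duration p]`, `x` is a collision-free solution of `x' = f (x, u)` from `x₀` under the
control `u` of `p`. The control is right-continuous, so the equation is required of the right
derivative of the continuous function `x`. -/
structure IsMotion (x₀ : Pt d) (p : Segs m) (x : ℝ → Pt d) : Prop where
  init : x 0 = x₀
  cont : ContinuousOn x (Icc 0 (duration p))
  free : ∀ t ∈ Icc 0 (duration p), x t ∈ P.Xfree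
  ode : ∀ t ∈ Ico 0 (duration p), HasDerivWithinAt x (P.f (x t) (inputAt p t)) (Ici t) t

/-- The running cost accumulated along a motion. -/
def runningCost (p : Segs m) (x : ℝ → Pt d) : ℝ :=
  ∫ t in (0 : ℝ)..duration p, P.run (x t) (inputAt p t)

/-- The total cost: accumulated running cost plus terminal cost of the endpoint. -/
def totalCost (p : Segs m) (x : ℝ → Pt d) : ℝ :=
  P.runningCost p x + P.term (x (duration p))

/-- A solution: a collision-free motion from the start state into the goal region, generated by at
least one constant control segment, with arbitrary positive segment durations. -/
structure IsSolution (p : Segs m) (x : ℝ → Pt d) : Prop where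
  nonempty : p ≠ []
  step : P.StepControl p
  motion : P.IsMotion P.start p x
  reach : x (duration p) ∈ P.goal

/-- A `δ`-robust trajectory: obstacle clearance and goal clearance are at least `δ`. -/
def HasClearance (δ : ℝ) (p : Segs m) (x : ℝ → Pt d) : Prop :=
  (∀ t ∈ Icc 0 (duration p), Metric.closedBall (x t) δ ⊆ P.Xfree) ∧
    Metric.closedBall (x (duration p)) δ ⊆ P.goal

/-- A robust trajectory with piecewise-constant control. -/
def IsRobust (p : Segs m) (x : ℝ → Pt d) : Prop :=
  P.IsSolution p x ∧ (∃ τ : ℝ, P.PiecewiseConstant τ p) ∧ ∃ δ : ℝ, 0 < δ ∧ P.HasClearance δ p x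

/-- The optimal robust cost `c*`. -/
def cStar : ℝ := sInf {c : ℝ | ∃ p x, P.IsRobust p x ∧ P.totalCost p x = c}

/-- Lipschitz continuity of the dynamics in the state and in the control. -/
def LipschitzDynamics : Prop :=
  ∃ Kx Ku : ℝ, 0 ≤ Kx ∧ 0 ≤ Ku ∧
    (∀ x ∈ P.X, ∀ x' ∈ P.X, ∀ u ∈ P.U, ‖P.f x u - P.f x' u‖ ≤ Kx * ‖x - x'‖) ∧
    (∀ x ∈ P.X, ∀ u ∈ P.U, ∀ u' ∈ P.U, ‖P.f x u - P.f x u'‖ ≤ Ku * ‖u - u'‖)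

/-- Lipschitz continuity of the running cost in the state and in the control. -/
def LipschitzRunningCost : Prop :=
  ∃ Kx Ku : ℝ, 0 ≤ Kx ∧ 0 ≤ Ku ∧
    (∀ x ∈ P.X, ∀ x' ∈ P.X, ∀ u ∈ P.U, |P.run x u - P.run x' u| ≤ Kx * ‖x - x'‖) ∧
    (∀ x ∈ P.X, ∀ u ∈ P.U, ∀ u' ∈ P.U, |P.run x u - P.run x u'| ≤ Ku * ‖u - u'‖)

/-- Lipschitz continuity of the terminal cost on the goal region. -/
def LipschitzTerminalCost : Prop :=
  ∃ K : ℝ, 0 ≤ K ∧ ∀ x ∈ P.goal, ∀ x' ∈ P.goal, |P.term x - P.term x'| ≤ K * ‖x - x'‖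

/-- The heuristic is admissible: it never exceeds the total cost of a motion from the given state
into the goal region (for a state in the goal this includes stopping at once). -/
def AdmissibleHeuristic : Prop :=
  ∀ (x₀ : Pt d) (p : Segs m) (x : ℝ → Pt d), P.StepControl p → P.IsMotion x₀ p x →
    x (duration p) ∈ P.goal → P.heur x₀ ≤ P.totalCost p x

/-- What is implicit in the planning problem: the uniform distributions on `X`, on `U` and on
`(0, Tp]` make sense, the samples from `U` come arbitrarily close to every control in `U`, costs are
nonnegative, and the heuristic is admissible. -/
structure Standing : Prop where
  free_subset : P.Xfree ⊆ P.X
  goal_subset : P.goal ⊆ P.X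
  X_meas : MeasurableSet P.X
  X_pos : volume P.X ≠ 0
  X_fin : volume P.X ≠ ⊤
  U_meas : MeasurableSet P.U
  U_pos : volume P.U ≠ 0
  U_fin : volume P.U ≠ ⊤
  U_fat : ∀ u ∈ P.U, ∀ r : ℝ, 0 < r → 0 < volume (Metric.ball u r ∩ P.U)
  Tp_pos : 0 < P.Tp
  run_nonneg : ∀ x ∈ P.X, ∀ u ∈ P.U, 0 ≤ P.run x u
  term_nonneg : ∀ x ∈ P.X, 0 ≤ P.term x
  heur_adm : P.AdmissibleHeuristic

end Problem

/-- A tree vertex `y = (x, c)`: state, accumulated running cost, and the path from the root to the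
vertex, recorded by its controls and durations (this encodes the edges). -/
structure Node (d m : ℕ) where
  path : Segs m
  x : Pt d
  c : ℝ

/-- The memory of the planner: the vertices of the tree, and the vertex `y_sol` of the best
solution found so far, if there is one. -/
structure Memory (d m : ℕ) where
  verts : Set (Node d m)
  sol : Option (Node d m)

/-- The random samples of one iteration: state, duration, control, and a number in `(0, 1)` from
which the cost sample `c_rand` in `(0, c_best)` is obtained by multiplication with `c_best`. -/
abbrev Sample (d m : ℕ) : Type := Pt d × ℝ × Pt m × ℝ

namespace Problem

variable (P : Problem d m)

/-- The law of the samples of one iteration: independent and uniform on `X`, `(0, Tp]`, `U` and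
`(0, 1)`. -/
def sampleLaw : Measure (Sample d m) :=
  (cond volume P.X).prod ((cond volume (Ioc 0 P.Tp)).prod
    ((cond volume P.U).prod (cond volume (Ioo 0 1))))

/-- Initially the tree is the root `(start, 0)` and there is no solution. -/
def initial : Memory d m := ⟨{⟨[], P.start, 0⟩}, none⟩

/-- The best cost `c_best`: `+∞` before the first solution, afterwards the accumulated running cost
plus the terminal cost of the best solution. -/
def best (S : Memory d m) : EReal :=
  match S.sol with
  | none => ⊤
  | some y => ((y.c + P.term y.x : ℝ) : EReal)

/-- The Euclidean distance of the augmented space. -/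
def augDist (x : Pt d) (c : ℝ) (x' : Pt d) (c' : ℝ) : ℝ :=
  Real.sqrt (dist x x' ^ 2 + |c - c'| ^ 2)

/-- `y` is a nearest vertex to the sample: in the state distance as long as there is no solution, in
the augmented distance to `(x_rand, c_rand)` afterwards. -/
def IsNearest (S : Memory d m) (xrand : Pt d) (v : ℝ) (y : Node d m) : Prop :=
  y ∈ S.verts ∧
    match S.sol with
    | none => ∀ y' ∈ S.verts, dist xrand y.x ≤ dist xrand y'.x
    | some s => ∀ y' ∈ S.verts,
        augDist xrand (v * (s.c + P.term s.x)) y.x y.c ≤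
          augDist xrand (v * (s.c + P.term s.x)) y'.x y'.c

open Classical in
/-- Treatment of a vertex reached by a valid motion: it is rejected if the cost bound cannot be
improved; otherwise it joins the tree, and if it is a better solution, then it becomes the best one
and all vertices with running cost above the new bound are pruned. -/
def addNode (S : Memory d m) (y : Node d m) : Memory d m :=
  if P.best S ≤ ((y.c + P.heur y.x : ℝ) : EReal) then S
  else if y.x ∈ P.goal ∧ ((y.c + P.term y.x : ℝ) : EReal) < P.best S then
    ⟨{w ∈ insert y S.verts | w.c ≤ y.c + P.term y.x}, some y⟩
  else ⟨insert y S.verts, S.sol⟩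

/-- One iteration of the planner with the sample `(x_rand, τ_rand, u_rand, v)`: a nearest vertex is
propagated with `u_rand` for the time `τ_rand`; an invalid motion is discarded. Ties between
nearest vertices may be broken in any way. -/
def Step (S : Memory d m) (s : Sample d m) (S' : Memory d m) : Prop :=
  ∃ y : Node d m, P.IsNearest S s.1 s.2.2.2 y ∧
    ((∃ x : ℝ → Pt d, P.IsMotion y.x [(s.2.2.1, s.2.1)] x ∧
        S' = P.addNode S ⟨y.path ++ [(s.2.2.1, s.2.1)], x s.2.1,
          y.c + P.runningCost [(s.2.2.1, s.2.1)] x⟩) ∨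
      ((¬ ∃ x : ℝ → Pt d, P.IsMotion y.x [(s.2.2.1, s.2.1)] x) ∧ S' = S))

/-- A random run of the planner: `S n` is its memory after `n` iterations and `ξ n` the sample of
the next iteration, drawn from the uniform law independently of the past `ℱ n`; the best cost is a
random variable which is determined by the past. -/
structure IsRun {Ω : Type*} [mΩ : MeasurableSpace Ω] (μ : Measure Ω) (ℱ : Filtration ℕ mΩ)
    (ξ : ℕ → Ω → Sample d m) (S : ℕ → Ω → Memory d m) : Prop where
  sample_meas : ∀ n, Measurable[ℱ (n + 1)] (ξ n)
  sample_law : ∀ n, μ.map (ξ n) = P.sampleLaw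
  sample_indep : ∀ n, Indep (ℱ n) (MeasurableSpace.comap (ξ n) inferInstance) μ
  init : ∀ ω, S 0 ω = P.initial
  step : ∀ n ω, P.Step (S n ω) (ξ n ω) (S (n + 1) ω)
  best_meas : ∀ n, Measurable[ℱ n] (fun ω => P.best (S n ω))

end Problem

end KiTe

end

/-!
The proof rests on the stability of short motions. A motion under a constant control that keeps a
clearance and is so short that it cannot use up this clearance is stable under perturbations of its
initial state, control and duration: existence of the perturbed motion is the Picard–Lindelöf
theorem, closeness of end states and costs is Grönwall's inequality (`IsMotion.tracks`). A robust
trajectory is a finite chain of such motions (`IsMotion.transGen`). Hence, choosing radii backwards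
from the goal, one obtains milestones along the trajectory, with neighbourhoods such that
propagation from near one milestone with roughly the right control and duration ends near the next
one (`Corridor`, `IsRobust.nonempty_corridor`). Following a chain with durations that are multiples
of a small `τ` (`exists_piecewiseConstant_of_transGen`) bounds the admissible heuristic near the
milestones, so that the vertices arising there are not rejected, and it also shows that every
solution is a limit of robust ones if the collision-free region and the goal are open
(`IsSolution.exists_isRobust`).

The corridor is traversed twice. Before the first solution, a vertex nearest in state distance to a
sample near a milestone is itself near that milestone; so good samples lead to some solution. After
that, the same holds in the augmented space, with control of the accumulated costs, and good samples
lead to a total cost below the bound of the corridor (`Corridor.progress`). Vertices near milestones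
are too cheap to be pruned as long as the bound is not reached. The tree is not assumed to be
measurable, only the best cost is. Therefore the progress is measured by a counter which is computed
from the best costs and the samples alone; deterministically, the milestones announced by the
counter have been reached (`Corridor.arrived_counter`).

A good sample has probability at least `γ > 0` given the past, as long as the best costs found are
at most `M` (`Corridor.exists_le_sampleLaw_good`). So on the event that the bound is not yet reached
the expectation of `2⁻¹ ^ counter` decays by the factor `1 - γ / 2` in each iteration, while the
counter stays below twice the number of milestones: the probability of this event decays
exponentially (`IsRun.measure_unsolved_le`). Almost sure convergence needs no bound on the costs,
since the best cost does not increase and hence is bounded from the first solution on; one takes the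
union over all natural numbers `M` (`IsRun.ae_exists_best_le`).
-/

namespace KiTe

variable {d m : ℕ}

/-! ### Concatenations of constant controls -/

@[simp] lemma duration_nil : duration ([] : Segs m) = 0 := rfl

@[simp] lemma duration_cons (s : Pt m × ℝ) (p : Segs m) :
    duration (s :: p) = s.2 + duration p := by simp [duration]

@[simp] lemma duration_append (p q : Segs m) :
    duration (p ++ q) = duration p + duration q := by simp [duration]

lemma duration_nonneg {p : Segs m} (hp : ∀ s ∈ p, 0 < s.2) : 0 ≤ duration p := by
  induction p with
  | nil => simp
  | cons s p ih =>
    have h1 := hp s (by simp)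
    have h2 := ih fun s hs => hp s (by simp [hs])
    rw [duration_cons]; linarith

lemma inputAt_append_left {p q : Segs m} {t : ℝ} (h0 : 0 ≤ t) (ht : t < duration p) :
    inputAt (p ++ q) t = inputAt p t := by
  induction p generalizing t with
  | nil => simp at ht; linarith
  | cons s p ih =>
    simp only [List.cons_append, inputAt]
    split_ifs with h
    · rfl
    · rw [duration_cons] at ht
      exact ih (by linarith) (by linarith)

lemma inputAt_append_right {p q : Segs m} (hp : ∀ s ∈ p, 0 < s.2) {t : ℝ}
    (ht : duration p ≤ t) : inputAt (p ++ q) t = inputAt q (t - duration p) := by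
  induction p generalizing t with
  | nil => simp
  | cons s p ih =>
    have h2 := duration_nonneg (p := p) fun s hs => hp s (by simp [hs])
    rw [duration_cons] at ht
    have : ¬ t < s.2 := by linarith
    simp only [List.cons_append, inputAt, this, if_false, duration_cons]
    rw [ih (fun s hs => hp s (by simp [hs])) (by linarith)]
    congr 1; ring

lemma inputAt_singleton {u : Pt m} {T t : ℝ} (ht : t < T) : inputAt [(u, T)] t = u := by
  simp [inputAt, ht]

namespace Problem

variable {P : Problem d m}

lemma StepControl.pos {p : Segs m} (hp : P.StepControl p) : ∀ s ∈ p, 0 < s.2 :=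
  fun s hs => (hp s hs).2

lemma StepControl.nil : P.StepControl [] := by simp [StepControl]

lemma StepControl.append {p q : Segs m} (hp : P.StepControl p) (hq : P.StepControl q) :
    P.StepControl (p ++ q) := by
  intro s hs
  rcases List.mem_append.1 hs with h | h
  · exact hp s h
  · exact hq s h

lemma StepControl.singleton {u : Pt m} {T : ℝ} (hu : u ∈ P.U) (hT : 0 < T) :
    P.StepControl [(u, T)] := by
  simp [StepControl, hu, hT]

lemma StepControl.inputAt_mem {p : Segs m} (hp : P.StepControl p) {t : ℝ}
    (ht : t ∈ Ico 0 (duration p)) : inputAt p t ∈ P.U := by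
  induction p generalizing t with
  | nil => simp at ht
  | cons s p ih =>
    simp only [inputAt]
    split_ifs with h
    · exact (hp s (by simp)).1
    · rw [duration_cons] at ht
      exact ih (fun s hs => hp s (by simp [hs])) ⟨by linarith, by linarith [ht.2]⟩

lemma PiecewiseConstant.stepControl {τ : ℝ} {p : Segs m} (hp : P.PiecewiseConstant τ p) :
    P.StepControl p := by
  intro s hs
  obtain ⟨hu, k, hk, h⟩ := hp.2 s hs
  refine ⟨hu, ?_⟩
  rw [h]
  exact mul_pos (by exact_mod_cast hk) hp.1

/-! ### Concatenation of motions -/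

lemma IsMotion.congr {x₀ : Pt d} {p : Segs m} {x y : ℝ → Pt d} (hx : P.IsMotion x₀ p x)
    (hp : 0 ≤ duration p) (h : EqOn y x (Icc 0 (duration p))) : P.IsMotion x₀ p y where
  init := by rw [h ⟨le_rfl, hp⟩, hx.init]
  cont := hx.cont.congr h
  free t ht := by rw [h ht]; exact hx.free t ht
  ode t ht := by
    rw [h (Ico_subset_Icc_self ht)]
    refine (hx.ode t ht).congr_of_eventuallyEq ?_ (h (Ico_subset_Icc_self ht))
    have : Ico t (duration p) ∈ 𝓝[≥] t := Ico_mem_nhdsGE ht.2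
    filter_upwards [this] with s hs
    exact h ⟨ht.1.trans hs.1, hs.2.le⟩

/-- The first part of a motion under a concatenated control. -/
lemma IsMotion.left {x₀ : Pt d} {p q : Segs m} {x : ℝ → Pt d} (hx : P.IsMotion x₀ (p ++ q) x)
    (hq : ∀ s ∈ q, 0 < s.2) : P.IsMotion x₀ p x := by
  have hq0 := duration_nonneg hq
  have hsub : Icc 0 (duration p) ⊆ Icc 0 (duration (p ++ q)) :=
    Icc_subset_Icc le_rfl (by rw [duration_append]; linarith)
  refine ⟨hx.init, hx.cont.mono hsub, fun t ht => hx.free t (hsub ht), fun t ht => ?_⟩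
  rw [← inputAt_append_left (q := q) ht.1 ht.2]
  exact hx.ode t ⟨ht.1, ht.2.trans_le (by rw [duration_append]; linarith)⟩

lemma hasDerivWithinAt_Ici_comp_add {x : ℝ → Pt d} {v : Pt d} {t a : ℝ}
    (h : HasDerivWithinAt x v (Ici (t + a)) (t + a)) :
    HasDerivWithinAt (fun s => x (s + a)) v (Ici t) t := by
  have h2 : HasDerivWithinAt (fun s : ℝ => s + a) 1 (Ici t) t :=
    (hasDerivWithinAt_id t _).add_const a
  have := HasDerivWithinAt.scomp (t' := Ici (t + a)) t h h2
    (fun s hs => by simpa using hs)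
  simpa [Function.comp_def] using this

/-- The second part of a motion under a concatenated control, with shifted time. -/
lemma IsMotion.right {x₀ : Pt d} {p q : Segs m} {x : ℝ → Pt d} (hx : P.IsMotion x₀ (p ++ q) x)
    (hp : ∀ s ∈ p, 0 < s.2) :
    P.IsMotion (x (duration p)) q (fun t => x (t + duration p)) := by
  have hp0 := duration_nonneg hp
  have hmaps : MapsTo (fun t => t + duration p) (Icc 0 (duration q))
      (Icc 0 (duration (p ++ q))) := by
    intro t ht
    rw [duration_append]
    exact ⟨by linarith [ht.1], by linarith [ht.2]⟩
  refine ⟨by simp, hx.cont.comp (by fun_prop) hmaps, fun t ht => hx.free _ (hmaps ht),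
    fun t ht => ?_⟩
  have h := hx.ode (t + duration p) ⟨by linarith [ht.1], by
    rw [duration_append]; linarith [ht.2]⟩
  rw [inputAt_append_right hp (by linarith [ht.1]), add_sub_cancel_right] at h
  exact hasDerivWithinAt_Ici_comp_add h

/-- Two motions with matching endpoint follow each other. -/
lemma IsMotion.append {x₀ : Pt d} {p q : Segs m} {x : ℝ → Pt d} (hp : ∀ s ∈ p, 0 < s.2)
    (hq : ∀ s ∈ q, 0 < s.2) (h1 : P.IsMotion x₀ p x)
    (h2 : P.IsMotion (x (duration p)) q (fun t => x (t + duration p))) :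
    P.IsMotion x₀ (p ++ q) x := by
  have hp0 := duration_nonneg hp
  have hq0 := duration_nonneg hq
  have hd : duration (p ++ q) = duration p + duration q := duration_append p q
  refine ⟨h1.init, ?_, fun t ht => ?_, fun t ht => ?_⟩
  · have hmaps : MapsTo (fun t => t - duration p) (Icc (duration p) (duration p + duration q))
        (Icc 0 (duration q)) := fun t ht => ⟨by linarith [ht.1], by linarith [ht.2]⟩
    have h3 : ContinuousOn x (Icc (duration p) (duration p + duration q)) := by
      have := h2.cont.comp (by fun_prop) hmaps
      simpa [Function.comp_def] using this
    have := h1.cont.union_of_isClosed h3 isClosed_Icc isClosed_Icc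
    rwa [Icc_union_Icc_eq_Icc hp0 (by linarith), ← hd] at this
  · rcases le_total t (duration p) with h | h
    · exact h1.free t ⟨ht.1, h⟩
    · have := h2.free (t - duration p) ⟨by linarith, by linarith [ht.2]⟩
      simpa using this
  · rcases lt_or_ge t (duration p) with h | h
    · rw [inputAt_append_left ht.1 h]
      exact h1.ode t ⟨ht.1, h⟩
    · rw [inputAt_append_right hp h]
      have := h2.ode (t - duration p) ⟨by linarith, by linarith [ht.2]⟩
      have h4 := hasDerivWithinAt_Ici_comp_add (a := -duration p) (t := t)
        (x := fun t => x (t + duration p)) (by simpa [sub_eq_add_neg] using this)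
      simpa [sub_eq_add_neg] using h4

/-- The curve that follows `x` until the time `T` and then `y`, started at its time `0`. -/
noncomputable def glue (T : ℝ) (x y : ℝ → Pt d) (t : ℝ) : Pt d := if t ≤ T then x t else y (t - T)

lemma glue_add {T : ℝ} {x y : ℝ → Pt d} (h : y 0 = x T) {t : ℝ} (ht : 0 ≤ t) :
    glue T x y (t + T) = y t := by
  rcases ht.eq_or_lt with rfl | ht
  · simp [glue, h]
  · simp [glue, not_le.2 ht]

lemma glue_of_le {T t : ℝ} {x y : ℝ → Pt d} (ht : t ≤ T) : glue T x y t = x t := by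
  simp [glue, ht]

lemma IsMotion.glue {x₀ : Pt d} {p q : Segs m} {x y : ℝ → Pt d} (hp : ∀ s ∈ p, 0 < s.2)
    (hq : ∀ s ∈ q, 0 < s.2) (h1 : P.IsMotion x₀ p x) (h2 : P.IsMotion (x (duration p)) q y) :
    P.IsMotion x₀ (p ++ q) (glue (duration p) x y) := by
  refine IsMotion.append hp hq (h1.congr (duration_nonneg hp) fun t ht => glue_of_le ht.2) ?_
  rw [glue_of_le le_rfl]
  exact h2.congr (duration_nonneg hq) fun t ht => glue_add h2.init ht.1

/-! ### Running costs along motions -/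

lemma LipschitzRunningCost.continuousOn (hrun : P.LipschitzRunningCost) {u : Pt m}
    (hu : u ∈ P.U) : ContinuousOn (fun x => P.run x u) P.X := by
  obtain ⟨Kx, Ku, hKx, -, h, -⟩ := hrun
  refine LipschitzOnWith.continuousOn (K := ⟨Kx, hKx⟩) (LipschitzOnWith.of_dist_le_mul ?_)
  intro x hx y hy
  rw [Real.dist_eq, dist_eq_norm]
  exact h x hx y hy u hu

lemma runningCost_singleton {u : Pt m} {T : ℝ} (hT : 0 ≤ T) (x : ℝ → Pt d) :
    P.runningCost [(u, T)] x = ∫ t in (0 : ℝ)..T, P.run (x t) u := by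
  have hd : duration [(u, T)] = T := by simp
  rw [runningCost, hd]
  refine intervalIntegral.integral_congr_Ioo_of_le hT fun t ht => ?_
  simp only [inputAt_singleton ht.2]

lemma runningCost_congr {p : Segs m} {x y : ℝ → Pt d} (hp : 0 ≤ duration p)
    (h : EqOn x y (Icc 0 (duration p))) : P.runningCost p x = P.runningCost p y := by
  refine intervalIntegral.integral_congr_Ioo_of_le hp fun t ht => ?_
  simp only [h (Ioo_subset_Icc_self ht)]

lemma intervalIntegrable_const_input (hrun : P.LipschitzRunningCost) {u : Pt m}
    (hu : u ∈ P.U) {x : ℝ → Pt d} {T : ℝ} (hT : 0 ≤ T) (hx : ContinuousOn x (Icc 0 T))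
    (hX : ∀ t ∈ Icc 0 T, x t ∈ P.X) :
    IntervalIntegrable (fun t => P.run (x t) u) volume 0 T := by
  refine ContinuousOn.intervalIntegrable ?_
  rw [uIcc_of_le hT]
  exact (hrun.continuousOn hu).comp hx hX

lemma intervalIntegrable_shift {g : ℝ → ℝ} {a b : ℝ}
    (h : IntervalIntegrable (fun t => g (t + a)) volume 0 b) :
    IntervalIntegrable g volume a (a + b) := by
  have := h.comp_sub_right a
  simpa [add_comm] using this

lemma IsMotion.intervalIntegrable (hP : P.Standing) (hrun : P.LipschitzRunningCost)
    {x₀ : Pt d} {p : Segs m} {x : ℝ → Pt d} (hx : P.IsMotion x₀ p x) (hp : P.StepControl p) :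
    IntervalIntegrable (fun t => P.run (x t) (inputAt p t)) volume 0 (duration p) := by
  induction p generalizing x₀ x with
  | nil => simp
  | cons s p ih =>
    have hs := hp s (by simp)
    have hp' : P.StepControl p := fun s hs => hp s (by simp [hs])
    have hs' : P.StepControl [s] := by simpa [StepControl] using hs
    have e : s :: p = [s] ++ p := rfl
    rw [e] at hx ⊢
    have h1 := hx.left hp'.pos
    have h2 := ih (hx.right hs'.pos) hp'
    have hd : duration [s] = s.2 := by simp
    rw [hd] at h2
    rw [duration_append, hd]
    refine IntervalIntegrable.trans (b := s.2) ?_ ?_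
    · refine (intervalIntegrable_const_input hrun hs.1 hs.2.le (hd ▸ h1.cont) fun t ht =>
        hP.free_subset (h1.free t (hd.symm ▸ ht))).congr_uIoo ?_
      rw [uIoo_of_le hs.2.le]
      intro t ht
      simp only [List.cons_append, List.nil_append, inputAt, ht.2, if_true]
    · refine intervalIntegrable_shift (h2.congr_uIoo ?_)
      rw [uIoo_of_le (duration_nonneg hp'.pos)]
      intro t ht
      have : ¬ t + s.2 < s.2 := by linarith [ht.1]
      simp [inputAt, this]

/-- Running costs add up along a concatenation. -/
lemma IsMotion.runningCost_append (hP : P.Standing) (hrun : P.LipschitzRunningCost)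
    {x₀ : Pt d} {p q : Segs m} {x : ℝ → Pt d} (hx : P.IsMotion x₀ (p ++ q) x)
    (hp : P.StepControl p) (hq : P.StepControl q) :
    P.runningCost (p ++ q) x =
      P.runningCost p x + P.runningCost q (fun t => x (t + duration p)) := by
  have hi := hx.intervalIntegrable hP hrun (hp.append hq)
  have hp0 := duration_nonneg hp.pos
  have hq0 := duration_nonneg hq.pos
  have hd : duration (p ++ q) = duration p + duration q := duration_append p q
  have hm : duration p ∈ uIcc 0 (duration (p ++ q)) := by
    rw [uIcc_of_le (by linarith), hd]; exact ⟨hp0, by linarith⟩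
  unfold runningCost
  rw [← intervalIntegral.integral_add_adjacent_intervals (b := duration p)
    (hi.mono_set (uIcc_subset_uIcc_left hm)) (hi.mono_set (uIcc_subset_uIcc_right hm))]
  congr 1
  · refine intervalIntegral.integral_congr_Ioo_of_le hp0 fun t ht => ?_
    simp only [inputAt_append_left (q := q) ht.1.le ht.2]
  · have := intervalIntegral.integral_comp_add_right (a := 0) (b := duration q)
      (fun t => P.run (x t) (inputAt (p ++ q) t)) (duration p)
    rw [zero_add, add_comm (duration q)] at this
    rw [hd, ← this]
    refine intervalIntegral.integral_congr_Ioo_of_le hq0 fun t ht => ?_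
    simp only
    rw [inputAt_append_right hp.pos (by linarith [ht.1]), add_sub_cancel_right]

lemma IsMotion.runningCost_glue (hP : P.Standing) (hrun : P.LipschitzRunningCost)
    {x₀ : Pt d} {p q : Segs m} {x y : ℝ → Pt d} (hp : P.StepControl p)
    (hq : P.StepControl q) (h1 : P.IsMotion x₀ p x) (h2 : P.IsMotion (x (duration p)) q y) :
    P.runningCost (p ++ q) (Problem.glue (duration p) x y) =
      P.runningCost p x + P.runningCost q y := by
  rw [(h1.glue hp.pos hq.pos h2).runningCost_append hP hrun hp hq]
  congr 1
  · exact runningCost_congr (duration_nonneg hp.pos) fun t ht => glue_of_le ht.2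
  · exact runningCost_congr (duration_nonneg hq.pos) fun t ht => glue_add h2.init ht.1

lemma IsMotion.runningCost_nonneg (hP : P.Standing) {x₀ : Pt d} {p : Segs m} {x : ℝ → Pt d}
    (hx : P.IsMotion x₀ p x) (hp : P.StepControl p) : 0 ≤ P.runningCost p x := by
  have hp0 := duration_nonneg hp.pos
  unfold runningCost
  rw [intervalIntegral.integral_of_le hp0, integral_Ioc_eq_integral_Ioo]
  refine setIntegral_nonneg measurableSet_Ioo fun t ht => ?_
  exact hP.run_nonneg _ (hP.free_subset (hx.free t (Ioo_subset_Icc_self ht))) _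
    (hp.inputAt_mem ⟨ht.1.le, ht.2⟩)

lemma IsSolution.totalCost_nonneg (hP : P.Standing) {p : Segs m} {x : ℝ → Pt d}
    (h : P.IsSolution p x) : 0 ≤ P.totalCost p x :=
  add_nonneg (h.motion.runningCost_nonneg hP h.step)
    (hP.term_nonneg _ (hP.goal_subset h.reach))

/-- Motions under a constant control are determined by their initial state. -/
lemma IsMotion.eqOn (hP : P.Standing) (hf : P.LipschitzDynamics) {x₀ : Pt d} {u : Pt m}
    (hu : u ∈ P.U) {T : ℝ} {x y : ℝ → Pt d} (hx : P.IsMotion x₀ [(u, T)] x)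
    (hy : P.IsMotion x₀ [(u, T)] y) : EqOn x y (Icc 0 T) := by
  obtain ⟨Kx, Ku, hKx, -, h, -⟩ := hf
  have hd : duration [(u, T)] = T := by simp
  have hx1 := hx.cont
  have hx2 := hx.ode
  have hx3 := hx.free
  have hy1 := hy.cont
  have hy2 := hy.ode
  have hy3 := hy.free
  rw [hd] at hx1 hx2 hx3 hy1 hy2 hy3
  refine ODE_solution_unique_of_mem_Icc_right (v := fun _ z => P.f z u) (s := fun _ => P.X)
    (K := ⟨Kx, hKx⟩) ?_ hx1 ?_ ?_ hy1 ?_ ?_ (hx.init.trans hy.init.symm)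
  · intro t _
    refine LipschitzOnWith.of_dist_le_mul fun a ha b hb => ?_
    rw [dist_eq_norm, dist_eq_norm]
    exact h a ha b hb u hu
  · intro t ht
    have := hx2 t ht
    rwa [inputAt_singleton ht.2] at this
  · exact fun t ht => hP.free_subset (hx3 t (Ico_subset_Icc_self ht))
  · intro t ht
    have := hy2 t ht
    rwa [inputAt_singleton ht.2] at this
  · exact fun t ht => hP.free_subset (hy3 t (Ico_subset_Icc_self ht))

end Problem

end KiTe

/-! ### Existence of integral curves in a ball -/

/-- The Picard–Lindelöf theorem, with the information that the solution stays in the ball in which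
the vector field is controlled. -/
lemma IsPicardLindelof.exists_curve_mem_closedBall {E : Type*} [NormedAddCommGroup E]
    [NormedSpace ℝ E] [CompleteSpace E] {f : ℝ → E → E} {tmin tmax : ℝ} {t₀ : Icc tmin tmax}
    {x₀ x : E} {a r L K : NNReal} (hf : IsPicardLindelof f t₀ x₀ a r L K)
    (hx : x ∈ Metric.closedBall x₀ r) :
    ∃ α : ℝ → E, α t₀ = x ∧ (∀ t, α t ∈ Metric.closedBall x₀ a) ∧
      ∀ t ∈ Icc tmin tmax, HasDerivWithinAt α (f t (α t)) (Icc tmin tmax) t := by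
  obtain ⟨α, hα⟩ := ODE.FunSpace.exists_isFixedPt_next hf hx
  refine ⟨α.compProj, by rw [ODE.FunSpace.compProj_val, ← hα, ODE.FunSpace.next_apply₀],
    fun t => α.compProj_mem_closedBall hf.mul_max_le, fun t ht ↦ ?_⟩
  apply ODE.hasDerivWithinAt_picard_Icc t₀.2 hf.continuousOn_uncurry
    α.continuous_compProj.continuousOn (fun _ ht' ↦ α.compProj_mem_closedBall hf.mul_max_le)
    x ht |>.congr_of_mem _ ht
  intro t' ht'
  nth_rw 1 [← hα]
  rw [ODE.FunSpace.compProj_of_mem ht', ODE.FunSpace.next_apply]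

namespace KiTe

variable {d m : ℕ}

namespace Problem

variable {P : Problem d m}

/-! ### Stability of short motions under perturbations -/

/-- The motion under the control `u` for the time `h` from the state `a.1` with cost `a.2` to the
state `b.1` with cost `b.2` is stable: propagating a nearby state with a nearby control for a
slightly smaller time is possible with clearance `δ`, ends close to `b.1`, and has nearly the
running cost `b.2 - a.2`. Durations above `h` are excluded, since the reference motion need not
extend beyond the time `h`. -/
def Tracks (P : Problem d m) (δ : ℝ) (u : Pt m) (h : ℝ) (a b : Pt d × ℝ) : Prop :=
  ∀ ε > 0, ∃ r > 0, ∀ z, dist z a.1 < r → ∀ u' ∈ P.U, dist u' u < r →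
    ∀ T, 0 < T → h - r < T → T ≤ h → ∃ y : ℝ → Pt d, P.IsMotion z [(u', T)] y ∧
      (∀ t ∈ Icc 0 T, Metric.closedBall (y t) δ ⊆ P.Xfree) ∧ dist (y T) b.1 < ε ∧
      |P.runningCost [(u', T)] y - (b.2 - a.2)| < ε

/-- A stable constant control motion between states with accumulated costs, whose duration can be
sampled by the planner. -/
def Link (P : Problem d m) (δ : ℝ) (a b : Pt d × ℝ) : Prop :=
  a.2 ≤ b.2 ∧ ∃ u ∈ P.U, ∃ h, 0 < h ∧ h ≤ P.Tp ∧ P.Tracks δ u h a b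

/-- Local existence of motions, with the information that they stay in the ball. -/
lemma exists_motion (hP : P.Standing) (hf : P.LipschitzDynamics) {z : Pt d} {u : Pt m}
    (hu : u ∈ P.U) {ρ L T : ℝ} (hρ : 0 ≤ ρ) (hL : 0 ≤ L) (hT : 0 ≤ T)
    (hfree : Metric.closedBall z ρ ⊆ P.Xfree)
    (hb : ∀ w ∈ Metric.closedBall z ρ, ‖P.f w u‖ ≤ L) (hLT : L * T ≤ ρ) :
    ∃ y, P.IsMotion z [(u, T)] y ∧ ∀ t ∈ Icc 0 T, y t ∈ Metric.closedBall z ρ := by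
  obtain ⟨Kx, Ku, hKx, -, hK, -⟩ := hf
  have hpl : IsPicardLindelof (fun _ z => P.f z u) (tmin := 0) (tmax := T) ⟨0, le_rfl, hT⟩ z
      (.mk ρ hρ) 0 (.mk L hL) (.mk Kx hKx) := by
    refine .of_time_independent hb ?_ ?_
    · refine LipschitzOnWith.of_dist_le_mul fun a ha b hb => ?_
      rw [dist_eq_norm, dist_eq_norm]
      exact hK a (hP.free_subset (hfree ha)) b (hP.free_subset (hfree hb)) u hu
    · simpa [hT] using hLT
  obtain ⟨α, hα0, hball, hder⟩ := hpl.exists_curve_mem_closedBall (x := z) (by simp)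
  have hd : duration [(u, T)] = T := by simp
  refine ⟨α, ⟨hα0, ?_, fun t _ => hfree (hball t), fun t ht => ?_⟩, fun t _ => hball t⟩
  · rw [hd]
    exact fun t ht => (hder t ht).continuousWithinAt
  rw [hd] at ht
  rw [inputAt_singleton ht.2]
  exact (hder t (Ico_subset_Icc_self ht)).mono_of_mem_nhdsWithin (Icc_mem_nhdsGE_of_mem ht)

/-- A motion of so short a duration that it cannot use up its clearance is stable. -/
lemma IsMotion.tracks (hP : P.Standing)
    (hrun : P.LipschitzRunningCost) {Kx Ku : ℝ} (hKx : 0 ≤ Kx) (hKu : 0 ≤ Ku)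
    (hfx : ∀ x ∈ P.X, ∀ x' ∈ P.X, ∀ u ∈ P.U, ‖P.f x u - P.f x' u‖ ≤ Kx * ‖x - x'‖)
    (hfu : ∀ x ∈ P.X, ∀ u ∈ P.U, ∀ u' ∈ P.U, ‖P.f x u - P.f x u'‖ ≤ Ku * ‖u - u'‖)
    {u : Pt m} (hu : u ∈ P.U) {h δ L : ℝ} (hh : 0 < h) (hδ : 0 < δ) (hL0 : 0 ≤ L)
    {x₀ : Pt d} {x : ℝ → Pt d} (hx : P.IsMotion x₀ [(u, h)] x)
    (hclear : ∀ t ∈ Icc 0 h, Metric.closedBall (x t) (4 * δ) ⊆ P.Xfree)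
    (hL : ∀ t ∈ Icc 0 h, ‖P.f (x t) u‖ ≤ L) (hshort : (L + Kx * (4 * δ) + Ku) * h ≤ 2 * δ)
    (c : ℝ) :
    P.Tracks δ u h (x₀, c) (x h, c + ∫ t in (0 : ℝ)..h, P.run (x t) u) := by
  have hd : ∀ T, duration [(u, T)] = T := fun T => by simp
  have hd' : ∀ u' T, duration [((u' : Pt m), T)] = T := fun u' T => by simp
  have hxc := hx.cont
  have hxo := hx.ode
  rw [hd] at hxc hxo
  have hxX : ∀ t ∈ Icc 0 h, x t ∈ P.X := fun t ht => hP.free_subset (hx.free t (by rwa [hd]))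
  obtain ⟨Rx, Ru, hRx, hRu, hrx, hru⟩ := hrun
  have hrun : P.LipschitzRunningCost := ⟨Rx, Ru, hRx, hRu, hrx, hru⟩
  -- the running cost along the reference motion is bounded
  have hkc : ContinuousOn (fun t => P.run (x t) u) (Icc 0 h) := (hrun.continuousOn hu).comp hxc hxX
  obtain ⟨R, hR⟩ := isCompact_Icc.exists_bound_of_continuousOn hkc
  have hR0 : 0 ≤ R := (norm_nonneg _).trans (hR 0 ⟨le_rfl, hh.le⟩)
  -- `G` is the amplification factor of Grönwall's inequality
  set K : ℝ := Kx + 1 with hKdef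
  have hK0 : 0 < K := by positivity
  set G : ℝ := Real.exp (K * h) + Ku / K * (Real.exp (K * h) - 1) with hG
  have hG0 : 0 ≤ G := by
    have : 0 ≤ Real.exp (K * h) - 1 := by
      have := Real.add_one_le_exp (K * h); nlinarith [mul_pos hK0 hh]
    positivity
  set W : ℝ := G + L + h * (Rx * G + Ru) + R + 1 with hW
  have hW0 : 0 < W := by positivity
  intro ε hε
  refine ⟨min (min 1 δ) (ε / (2 * W)), by positivity, ?_⟩
  set r := min (min 1 δ) (ε / (2 * W)) with hr
  have hr0 : 0 < r := by positivity
  have hr1 : r ≤ 1 := (min_le_left _ _).trans (min_le_left _ _)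
  have hrδ : r ≤ δ := (min_le_left _ _).trans (min_le_right _ _)
  have hrW : r * W < ε := by
    have : r ≤ ε / (2 * W) := min_le_right _ _
    rw [le_div_iff₀ (by positivity)] at this
    linarith
  intro z hz u' hu' huu T hT0 hTr hTh
  simp only at hz
  have hx0 : x 0 = x₀ := hx.init
  have h00 : (0 : ℝ) ∈ Icc 0 h := ⟨le_rfl, hh.le⟩
  have hball : ∀ w ∈ Metric.closedBall z (2 * δ), ∀ v, dist v w ≤ δ → v ∈ P.Xfree := by
    intro w hw v hv
    refine hclear 0 h00 ?_
    rw [Metric.mem_closedBall, hx0]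
    rw [Metric.mem_closedBall] at hw
    linarith [dist_triangle v w x₀, dist_triangle w z x₀]
  have hballX : Metric.closedBall z (2 * δ) ⊆ P.Xfree := fun w hw =>
    hball w hw w (by simpa using hδ.le)
  obtain ⟨y, hy, hyb⟩ := exists_motion hP ⟨Kx, Ku, hKx, hKu, hfx, hfu⟩ (z := z) hu'
    (ρ := 2 * δ) (L := L + Kx * (4 * δ) + Ku) (T := T) (by positivity) (by positivity) hT0.le
    hballX (by
      intro w hw
      have hwX := hP.free_subset (hballX hw)
      have hxX0 := hxX 0 h00
      have h1 := hfu w hwX u' hu' u hu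
      have h2 := hfx w hwX (x 0) hxX0 u hu
      have h3 := hL 0 h00
      rw [← dist_eq_norm u' u] at h1
      rw [← dist_eq_norm w (x 0), hx0] at h2
      rw [Metric.mem_closedBall] at hw
      have h4 : Ku * dist u' u ≤ Ku * 1 := by gcongr; linarith
      have h5 : Kx * dist w x₀ ≤ Kx * (4 * δ) := by
        gcongr; linarith [dist_triangle w z x₀]
      have h6 : P.f w u' = (P.f w u' - P.f w u) + (P.f w u - P.f (x 0) u) + P.f (x 0) u := by abel
      rw [h6]
      refine (norm_add₃_le).trans ?_
      rw [hx0] at h3 ⊢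
      linarith)
    ((mul_le_mul_of_nonneg_left hTh (by positivity)).trans hshort)
  have hyc := hy.cont
  have hyo := hy.ode
  have hyf := hy.free
  rw [hd'] at hyc hyo hyf
  have hyX : ∀ t ∈ Icc 0 T, y t ∈ P.X := fun t ht => hP.free_subset (hyf t ht)
  have hsub : Icc 0 T ⊆ Icc 0 h := Icc_subset_Icc le_rfl hTh
  have hsub' : Ico 0 T ⊆ Ico 0 h := Ico_subset_Ico le_rfl hTh
  -- both motions stay close, by Grönwall's inequality
  have hclose : ∀ t ∈ Icc 0 T, dist (y t) (x t) ≤ r * G := by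
    intro t ht
    have := dist_le_of_approx_trajectories_ODE_of_mem (v := fun _ w => P.f w u')
      (s := fun _ => P.X) (K := .mk K hK0.le) (f := y) (g := x) (a := 0) (b := T)
      (f' := fun t => P.f (y t) u') (g' := fun t => P.f (x t) u)
      (εf := 0) (εg := Ku * r) (δ := r) ?_ hyc ?_ ?_ ?_ (hxc.mono hsub) ?_ ?_ ?_ ?_ t ht
    · refine this.trans ?_
      refine (gronwallBound_mono hr0.le (by positivity) hK0.le
        (show t - 0 ≤ h by linarith [ht.2])).trans (le_of_eq ?_)
      rw [gronwallBound_of_K_ne_0 hK0.ne', hG]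
      simp only; ring
    · intro t _
      refine LipschitzOnWith.of_dist_le_mul fun a ha b hb => ?_
      rw [dist_eq_norm, dist_eq_norm]
      refine (hfx a ha b hb u' hu').trans ?_
      exact mul_le_mul_of_nonneg_right (show Kx ≤ K by linarith) (norm_nonneg _)
    · intro t ht
      have := hyo t ht
      rwa [inputAt_singleton ht.2] at this
    · intro t _; simp
    · exact fun t ht => hyX t (Ico_subset_Icc_self ht)
    · intro t ht
      have := hxo t (hsub' ht)
      rwa [inputAt_singleton (hsub' ht).2] at this
    · intro t ht
      rw [dist_eq_norm]
      refine (hfu _ (hxX t (hsub (Ico_subset_Icc_self ht))) u hu u' hu').trans ?_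
      rw [← dist_eq_norm, dist_comm]
      gcongr
    · exact fun t ht => hxX t (hsub (Ico_subset_Icc_self ht))
    · rw [hx0, hy.init]; exact hz.le
  have hTT : T ∈ Icc 0 T := ⟨hT0.le, le_rfl⟩
  have hTr' : h - T ≤ r := by linarith
  refine ⟨y, hy, fun t ht v hv => hball _ (hyb t ht) v hv, ?_, ?_⟩
  · have h1 : ‖x h - x T‖ ≤ L * (h - T) := by
      refine norm_image_sub_le_of_norm_deriv_right_le_segment (a := T) (b := h)
        (f' := fun t => P.f (x t) u) (hxc.mono (Icc_subset_Icc hT0.le le_rfl)) ?_ ?_ h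
        ⟨hTh, le_rfl⟩
      · intro t ht
        have := hxo t ⟨hT0.le.trans ht.1, ht.2⟩
        rwa [inputAt_singleton ht.2] at this
      · exact fun t ht => hL t ⟨hT0.le.trans ht.1, ht.2.le⟩
    rw [← dist_eq_norm] at h1
    have h2 : L * (h - T) ≤ L * r := by gcongr
    refine lt_of_le_of_lt ?_ hrW
    have h3 := hclose T hTT
    have h4 : 0 ≤ r * (h * (Rx * G + Ru) + R + 1) := by positivity
    calc dist (y T) (x h) ≤ dist (y T) (x T) + dist (x h) (x T) := dist_triangle_right _ _ _
      _ ≤ r * W := by rw [hW]; nlinarith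
  · have hky : IntervalIntegrable (fun t => P.run (y t) u') volume 0 T :=
      intervalIntegrable_const_input hrun hu' hT0.le hyc hyX
    have hkx : IntervalIntegrable (fun t => P.run (x t) u) volume 0 h :=
      intervalIntegrable_const_input hrun hu hh.le hxc hxX
    have hTm : T ∈ uIcc 0 h := by rw [uIcc_of_le hh.le]; exact ⟨hT0.le, hTh⟩
    have hkx1 := hkx.mono_set (uIcc_subset_uIcc_left hTm)
    have hkx2 := hkx.mono_set (uIcc_subset_uIcc_right hTm)
    rw [runningCost_singleton hT0.le, ← intervalIntegral.integral_add_adjacent_intervals hkx1 hkx2]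
    have e : ∀ A B C : ℝ, A - (c + (B + C) - c) = (A - B) - C := by intros; ring
    simp only [e]
    rw [← intervalIntegral.integral_sub hky hkx1]
    have h1 : ‖∫ t in (0 : ℝ)..T, (P.run (y t) u' - P.run (x t) u)‖ ≤
        (Rx * (r * G) + Ru * r) * |T - 0| := by
      refine intervalIntegral.norm_integral_le_of_norm_le_const fun t ht => ?_
      rw [uIoc_of_le hT0.le] at ht
      have ht' := Ioc_subset_Icc_self ht
      have h2 := hrx _ (hyX t ht') _ (hxX t (hsub ht')) u' hu'
      have h3 := hru _ (hxX t (hsub ht')) u' hu' u hu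
      rw [← dist_eq_norm] at h2 h3
      have h4 : Rx * dist (y t) (x t) ≤ Rx * (r * G) := by gcongr; exact hclose t ht'
      have h5 : Ru * dist u' u ≤ Ru * r := by gcongr
      rw [Real.norm_eq_abs]
      refine (abs_sub_le _ (P.run (x t) u') _).trans ?_
      linarith
    have h2 : ‖∫ t in T..h, P.run (x t) u‖ ≤ R * |h - T| := by
      refine intervalIntegral.norm_integral_le_of_norm_le_const fun t ht => ?_
      rw [uIoc_of_le hTh] at ht
      exact hR t ⟨hT0.le.trans ht.1.le, ht.2⟩
    rw [sub_zero, abs_of_pos hT0] at h1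
    rw [abs_of_nonneg (by linarith)] at h2
    rw [Real.norm_eq_abs] at h1 h2
    have h3 : (Rx * (r * G) + Ru * r) * T ≤ (Rx * (r * G) + Ru * r) * h := by gcongr
    have h4 : R * (h - T) ≤ R * r := by gcongr
    refine lt_of_le_of_lt ((abs_sub _ _).trans (add_le_add h1 h2)) (lt_of_le_of_lt ?_ hrW)
    have h5 : 0 ≤ r * (G + L + 1) := by positivity
    rw [hW]; nlinarith

/-! ### Motions with clearance as chains of stable short motions -/

lemma IsMotion.sub_arc {x₀ : Pt d} {u : Pt m} {T a h : ℝ} {x : ℝ → Pt d}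
    (hx : P.IsMotion x₀ [(u, T)] x) (ha : 0 ≤ a) (hT : a + h ≤ T) :
    P.IsMotion (x a) [(u, h)] (fun t => x (t + a)) := by
  have hd : ∀ T, duration [(u, T)] = T := fun T => by simp
  have hxc := hx.cont
  have hxo := hx.ode
  have hxf := hx.free
  rw [hd] at hxc hxo hxf
  have hmaps : MapsTo (fun t => t + a) (Icc 0 h) (Icc 0 T) := fun t ht =>
    ⟨by linarith [ht.1], by linarith [ht.2]⟩
  refine ⟨by simp, ?_, ?_, ?_⟩ <;> rw [hd]
  · exact hxc.comp (by fun_prop) hmaps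
  · exact fun t ht => hxf _ (hmaps ht)
  · intro t ht
    have h1 : t + a < T := by linarith [ht.2]
    have := hxo (t + a) ⟨by linarith [ht.1], h1⟩
    rw [inputAt_singleton h1] at this
    rw [inputAt_singleton ht.2]
    exact hasDerivWithinAt_Ici_comp_add this

lemma LipschitzDynamics.continuousOn (hf : P.LipschitzDynamics) {u : Pt m}
    (hu : u ∈ P.U) : ContinuousOn (fun x => P.f x u) P.X := by
  obtain ⟨Kx, Ku, hKx, -, h, -⟩ := hf
  refine LipschitzOnWith.continuousOn (K := .mk Kx hKx) (LipschitzOnWith.of_dist_le_mul ?_)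
  intro x hx y hy
  rw [dist_eq_norm, dist_eq_norm]
  exact h x hx y hy u hu

/-- A constant control motion with clearance is divided into equal parts which are short enough to
be stable and to be sampled. -/
lemma IsMotion.transGen_singleton (hP : P.Standing) (hf : P.LipschitzDynamics)
    (hrun : P.LipschitzRunningCost) {u : Pt m} (hu : u ∈ P.U) {T δ : ℝ} (hT : 0 < T)
    (hδ : 0 < δ) {x₀ : Pt d} {x : ℝ → Pt d} (hx : P.IsMotion x₀ [(u, T)] x)
    (hclear : ∀ t ∈ Icc 0 T, Metric.closedBall (x t) (4 * δ) ⊆ P.Xfree) (c : ℝ) :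
    Relation.TransGen (P.Link δ) (x₀, c) (x T, c + P.runningCost [(u, T)] x) := by
  have hd : duration [(u, T)] = T := by simp
  have hxc := hx.cont
  rw [hd] at hxc
  have hxX : ∀ t ∈ Icc 0 T, x t ∈ P.X := fun t ht => hP.free_subset (hx.free t (by rwa [hd]))
  obtain ⟨L, hL⟩ := isCompact_Icc.exists_bound_of_continuousOn
    ((hf.continuousOn hu).comp hxc hxX)
  have hL0 : 0 ≤ L := (norm_nonneg _).trans (hL 0 ⟨le_rfl, hT.le⟩)
  obtain ⟨Kx, Ku, hKx, hKu, hfx, hfu⟩ := id hf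
  have hTp := hP.Tp_pos
  set A := L + Kx * (4 * δ) + Ku with hA
  have hA0 : 0 ≤ A := by positivity
  obtain ⟨N, hN⟩ := exists_nat_gt (max (T / P.Tp) (A * T / (2 * δ)))
  have hN1 : T / P.Tp < N := (le_max_left _ _).trans_lt hN
  have hN2 : A * T / (2 * δ) < N := (le_max_right _ _).trans_lt hN
  have hN0 : (0 : ℝ) < N := lt_trans (by positivity) hN1
  rw [div_lt_iff₀ hTp] at hN1
  rw [div_lt_iff₀ (by positivity)] at hN2
  set h := T / N with hh
  have hh0 : 0 < h := by positivity
  have hhp : h ≤ P.Tp := by rw [hh, div_le_iff₀ hN0]; linarith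
  have hAh : A * h ≤ 2 * δ := by
    rw [hh, ← mul_div_assoc, div_le_iff₀ hN0]; linarith
  have hNh : N * h = T := by rw [hh]; field_simp
  have hint := intervalIntegrable_const_input hrun hu hT.le hxc hxX
  -- one part of the motion
  have hlink : ∀ a, 0 ≤ a → a + h ≤ T →
      P.Link δ (x a, c + ∫ t in (0 : ℝ)..a, P.run (x t) u)
        (x (a + h), c + ∫ t in (0 : ℝ)..(a + h), P.run (x t) u) := by
    intro a ha hah
    have hm := hx.sub_arc ha hah
    have hsub : ∀ t ∈ Icc 0 h, t + a ∈ Icc 0 T := fun t ht =>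
      ⟨by linarith [ht.1], by linarith [ht.2]⟩
    have htr := hm.tracks hP hrun hKx hKu hfx hfu hu hh0 hδ hL0
      (fun t ht => hclear _ (hsub t ht)) (fun t ht => hL _ (hsub t ht)) hAh
      (c + ∫ t in (0 : ℝ)..a, P.run (x t) u)
    have hi1 : IntervalIntegrable (fun t => P.run (x t) u) volume 0 a :=
      hint.mono_set (by
        rw [uIcc_of_le ha, uIcc_of_le hT.le]; exact Icc_subset_Icc le_rfl (by linarith))
    have hi2 : IntervalIntegrable (fun t => P.run (x t) u) volume a (a + h) :=
      hint.mono_set (by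
        rw [uIcc_of_le (by linarith), uIcc_of_le hT.le]; exact Icc_subset_Icc ha hah)
    have he : c + (∫ t in (0 : ℝ)..a, P.run (x t) u) + ∫ t in (0 : ℝ)..h, P.run (x (t + a)) u =
        c + ∫ t in (0 : ℝ)..(a + h), P.run (x t) u := by
      rw [← intervalIntegral.integral_add_adjacent_intervals hi1 hi2,
        intervalIntegral.integral_comp_add_right (fun t => P.run (x t) u) a, zero_add,
        add_comm h a, add_assoc]
    rw [he, add_comm h a] at htr
    refine ⟨?_, u, hu, h, hh0, hhp, htr⟩
    simp only
    rw [← he]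
    have := hm.runningCost_nonneg hP (.singleton hu hh0)
    rw [runningCost_singleton hh0.le] at this
    linarith
  have hchain : ∀ k : ℕ, 1 ≤ k → (k : ℝ) * h ≤ T → Relation.TransGen (P.Link δ) (x₀, c)
      (x (k * h), c + ∫ t in (0 : ℝ)..(k * h), P.run (x t) u) := by
    intro k hk
    induction k, hk using Nat.le_induction with
    | base =>
      intro h1
      refine .single ?_
      have := hlink 0 le_rfl (by simpa using h1)
      simpa [hx.init] using this
    | succ k hk ih =>
      intro h1
      have e : ((k + 1 : ℕ) : ℝ) * h = k * h + h := by push_cast; ring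
      rw [e] at h1 ⊢
      exact (ih (by linarith)).tail (hlink _ (by positivity) h1)
  have := hchain N (by exact_mod_cast hN0) hNh.le
  rwa [hNh, ← runningCost_singleton hT.le] at this

lemma IsMotion.transGen (hP : P.Standing) (hf : P.LipschitzDynamics)
    (hrun : P.LipschitzRunningCost) {δ : ℝ} (hδ : 0 < δ) {p : Segs m} (hne : p ≠ [])
    (hp : P.StepControl p) {x₀ : Pt d} {x : ℝ → Pt d} (hx : P.IsMotion x₀ p x)
    (hclear : ∀ t ∈ Icc 0 (duration p), Metric.closedBall (x t) (4 * δ) ⊆ P.Xfree) (c : ℝ) :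
    Relation.TransGen (P.Link δ) (x₀, c) (x (duration p), c + P.runningCost p x) := by
  induction p generalizing x₀ x c with
  | nil => exact absurd rfl hne
  | cons s p ih =>
    obtain ⟨u, T⟩ := s
    have hs := hp (u, T) (by simp)
    rcases eq_or_ne p [] with rfl | hp0
    · have := hx.transGen_singleton hP hf hrun hs.1 hs.2 hδ (by simpa using hclear) c
      simpa using this
    · have hp' : P.StepControl p := fun s hs => hp s (by simp [hs])
      have hs' : P.StepControl [(u, T)] := .singleton hs.1 hs.2
      have e : (u, T) :: p = [(u, T)] ++ p := rfl
      rw [e] at hx hclear ⊢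
      have hd : duration [(u, T)] = T := by simp
      have hd0 := duration_nonneg hp'.pos
      rw [duration_append, hd] at hclear
      have hT : 0 < T := hs.2
      have h1 := (hx.left hp'.pos).transGen_singleton hP hf hrun hs.1 hT hδ
        (fun t ht => hclear t ⟨ht.1, by linarith [ht.2]⟩) c
      have h2 := ih hp0 hp' (hx.right hs'.pos)
        (fun t ht => hclear _ ⟨by rw [hd]; linarith [ht.1], by rw [hd]; linarith [ht.2]⟩)
        (c + P.runningCost [(u, T)] x)
      rw [hd] at h2
      have h3 := hx.runningCost_append hP hrun hs' hp'
      rw [hd] at h3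
      rw [duration_append, h3, ← add_assoc, hd, add_comm T]
      exact h1.trans h2

/-- A chain of stable motions can be followed from every state close to its start, with controls
whose durations are multiples of any sufficiently small `τ`. -/
lemma exists_piecewiseConstant_of_transGen (hP : P.Standing) (hrun : P.LipschitzRunningCost)
    {δ : ℝ} {a b : Pt d × ℝ} (hab : Relation.TransGen (P.Link δ) a b) :
    ∀ ε > 0, ∃ r > 0, ∀ z, dist z a.1 < r → ∀ τ, 0 < τ → τ < r → ∃ (p : Segs m) (y : ℝ → Pt d),
      p ≠ [] ∧ P.PiecewiseConstant τ p ∧ P.IsMotion z p y ∧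
      (∀ t ∈ Icc 0 (duration p), Metric.closedBall (y t) δ ⊆ P.Xfree) ∧
      dist (y (duration p)) b.1 < ε ∧ |P.runningCost p y - (b.2 - a.2)| < ε := by
  -- the single link, controlled for a multiple of `τ` just below the duration of the link
  have hlink : ∀ a b, P.Link δ a b → ∀ ε > 0, ∃ r > 0, ∀ z, dist z a.1 < r → ∀ τ, 0 < τ → τ < r →
      ∃ (p : Segs m) (y : ℝ → Pt d),
      p ≠ [] ∧ P.PiecewiseConstant τ p ∧ P.IsMotion z p y ∧
      (∀ t ∈ Icc 0 (duration p), Metric.closedBall (y t) δ ⊆ P.Xfree) ∧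
      dist (y (duration p)) b.1 < ε ∧ |P.runningCost p y - (b.2 - a.2)| < ε := by
    rintro a b ⟨-, u, hu, h, hh, -, htr⟩ ε hε
    obtain ⟨r, hr, H⟩ := htr ε hε
    refine ⟨min r h, by positivity, fun z hz τ hτ hτr => ?_⟩
    have hτr1 : τ < r := hτr.trans_le (min_le_left _ _)
    have hτh : τ < h := hτr.trans_le (min_le_right _ _)
    have hk : 0 < ⌊h / τ⌋₊ := Nat.floor_pos.2 (by rw [one_le_div hτ]; exact hτh.le)
    have hk1 : (⌊h / τ⌋₊ : ℝ) * τ ≤ h := by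
      rw [← le_div_iff₀ hτ]; exact Nat.floor_le (by positivity)
    have hk2 : h - τ < (⌊h / τ⌋₊ : ℝ) * τ := by
      have := Nat.lt_floor_add_one (h / τ)
      rw [div_lt_iff₀ hτ] at this; linarith
    have hk' : (0 : ℝ) < ⌊h / τ⌋₊ := by exact_mod_cast hk
    obtain ⟨y, hy, hc, hd, hcost⟩ := H z (hz.trans_le (min_le_left _ _)) u hu (by simpa using hr)
      (⌊h / τ⌋₊ * τ) (by positivity) (by linarith) hk1
    have hdur : duration [(u, (⌊h / τ⌋₊ : ℝ) * τ)] = ⌊h / τ⌋₊ * τ := by simp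
    refine ⟨[(u, ⌊h / τ⌋₊ * τ)], y, by simp, ⟨hτ, ?_⟩, hy, by rwa [hdur], by rwa [hdur], hcost⟩
    intro s hs
    rw [List.mem_singleton] at hs
    subst hs
    exact ⟨hu, _, hk, rfl⟩
  induction hab using Relation.TransGen.head_induction_on with
  | single h => exact hlink _ _ h
  | head h _ ih =>
    intro ε hε
    obtain ⟨r₂, hr₂, H₂⟩ := ih (ε / 2) (by positivity)
    obtain ⟨r₁, hr₁, H₁⟩ := hlink _ _ h (min r₂ (ε / 2)) (by positivity)
    refine ⟨min r₁ r₂, by positivity, fun z hz τ hτ hτr => ?_⟩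
    obtain ⟨p, x, -, hp, hx, hxc, hxd, hxcost⟩ := H₁ z (hz.trans_le (min_le_left _ _)) τ hτ
      (hτr.trans_le (min_le_left _ _))
    obtain ⟨q, y, hq0, hq, hy, hyc, hyd, hycost⟩ := H₂ (x (duration p))
      (hxd.trans_le (min_le_left _ _)) τ hτ (hτr.trans_le (min_le_right _ _))
    have hps := hp.stepControl
    have hqs := hq.stepControl
    refine ⟨p ++ q, Problem.glue (duration p) x y, by simp [hq0], ⟨hτ, ?_⟩,
      hx.glue hps.pos hqs.pos hy, ?_, ?_, ?_⟩
    · intro s hs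
      rcases List.mem_append.1 hs with h | h
      · exact hp.2 s h
      · exact hq.2 s h
    · intro t ht
      rw [duration_append] at ht
      rcases le_total t (duration p) with h | h
      · rw [glue_of_le h]; exact hxc t ⟨ht.1, h⟩
      · have := glue_add hy.init (t := t - duration p) (by linarith)
        rw [sub_add_cancel] at this
        rw [this]
        exact hyc _ ⟨by linarith, by linarith [ht.2]⟩
    · rw [duration_append, add_comm, glue_add hy.init (duration_nonneg hqs.pos)]
      linarith
    · rw [hx.runningCost_glue hP hrun hps hqs hy]
      have h1 := hxcost.trans_le (min_le_right _ _)
      rw [abs_lt] at h1 hycost ⊢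
      constructor <;> linarith [h1.1, h1.2, hycost.1, hycost.2]

lemma LipschitzTerminalCost.exists_close (hterm : P.LipschitzTerminalCost) {z : Pt d} {δ : ℝ}
    (hδ : 0 < δ) (hz : Metric.closedBall z δ ⊆ P.goal) {ε : ℝ} (hε : 0 < ε) :
    ∃ r > 0, ∀ w, dist w z < r → w ∈ P.goal ∧ |P.term w - P.term z| < ε := by
  obtain ⟨K, hK, h⟩ := hterm
  refine ⟨min δ (ε / (K + 1)), by positivity, fun w hw => ?_⟩
  have h1 : w ∈ P.goal := hz (hw.le.trans (min_le_left _ _))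
  refine ⟨h1, (h w h1 z (hz (Metric.mem_closedBall_self hδ.le))).trans_lt ?_⟩
  rw [← dist_eq_norm]
  have h2 := hw.trans_le (min_le_right _ _)
  rw [lt_div_iff₀ (by positivity)] at h2
  nlinarith [dist_nonneg (x := w) (y := z)]

end Problem

end KiTe

/-! ### Finite chains -/

/-- A nonempty chain, indexed by natural numbers. -/
lemma Relation.TransGen.exists_seq {α : Type*} {R : α → α → Prop} {a b : α}
    (h : Relation.TransGen R a b) :
    ∃ K > 0, ∃ s : ℕ → α, s 0 = a ∧ s K = b ∧ ∀ i < K, R (s i) (s (i + 1)) := by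
  induction h with
  | @single b h => exact ⟨1, one_pos, fun i => if i = 0 then a else b, by simp, by simp, by
      intro i hi
      obtain rfl : i = 0 := by omega
      simpa using h⟩
  | @tail b c _ h ih =>
    obtain ⟨K, hK, s, h0, hKs, hs⟩ := ih
    refine ⟨K + 1, by omega, fun i => if i ≤ K then s i else c, by simpa using h0, by simp, ?_⟩
    intro i hi
    rcases (Nat.lt_succ_iff.1 hi).lt_or_eq with hi' | rfl
    · have h1 : i ≤ K := hi'.le
      have h2 : i + 1 ≤ K := hi'
      simpa [h1, h2] using hs i hi'
    · simpa [hKs] using h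

lemma Relation.TransGen.of_seq {α : Type*} {R : α → α → Prop} {s : ℕ → α} {i k : ℕ} (hik : i < k)
    (hs : ∀ j < k, R (s j) (s (j + 1))) : Relation.TransGen R (s i) (s k) := by
  induction k, hik using Nat.le_induction with
  | base => exact .single (hs i (by omega))
  | succ k hik ih => exact (ih fun j hj => hs j (by omega)).tail (hs k (by omega))

/-- Radii chosen backwards from the last one. -/
lemma exists_backward_seq {A : ℕ → ℝ → ℝ → Prop} (K : ℕ)
    (h : ∀ i < K, ∀ ε > 0, ∃ r > 0, A i ε r) {ε₀ : ℝ} (hε₀ : 0 < ε₀) :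
    ∃ r : ℕ → ℝ, (∀ i, 0 < r i) ∧ r K = ε₀ ∧ ∀ i < K, A i (r (i + 1)) (r i) := by
  induction K generalizing ε₀ with
  | zero => exact ⟨fun _ => ε₀, fun _ => hε₀, rfl, by simp⟩
  | succ K ih =>
    obtain ⟨ε₁, hε₁, h1⟩ := h K (by omega) ε₀ hε₀
    obtain ⟨r, hr, hrK, hr'⟩ := ih (fun i hi => h i (by omega)) hε₁
    refine ⟨fun i => if i ≤ K then r i else ε₀, ?_, by simp, ?_⟩
    · intro i
      simp only
      split_ifs
      exacts [hr i, hε₀]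
    · intro i hi
      rcases (Nat.lt_succ_iff.1 hi).lt_or_eq with hi' | rfl
      · have h1 : i ≤ K := hi'.le
        have h2 : i + 1 ≤ K := hi'
        simpa [h1, h2] using hr' i hi'
      · simpa [hrK] using h1

namespace KiTe

variable {d m : ℕ}

namespace Problem

variable {P : Problem d m}

/-! ### The corridor around a robust trajectory -/

/-- Milestones `(x i, c i)`, `i ≤ K`, along a trajectory of total cost less than `B`, with radii
`r i` such that propagating a state in the ball of radius `5 * r i` around `x i` with nearly the
control `u i` and nearly the duration `h i` leads into the ball of radius `r (i + 1)` around
`x (i + 1)`, with the corresponding estimate for the costs. The factor `5` accounts for the distance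
between a milestone and the vertex nearest to a sample. Near a milestone the heuristic does not
exclude a total cost below `B`. -/
structure Corridor (P : Problem d m) (B : ℝ) where
  K : ℕ
  x : ℕ → Pt d
  c : ℕ → ℝ
  u : ℕ → Pt m
  h : ℕ → ℝ
  r : ℕ → ℝ
  K_pos : 0 < K
  r_pos : ∀ i, 0 < r i
  x_zero : x 0 = P.start
  c_zero : c 0 = 0
  c_nonneg : ∀ i ≤ K, 0 ≤ c i
  le_bound : ∀ i ≤ K, c i + r i ≤ B
  ball_free : ∀ i < K, Metric.ball (x i) (r i) ⊆ P.Xfree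
  u_mem : ∀ i < K, u i ∈ P.U
  h_pos : ∀ i < K, 0 < h i
  h_le : ∀ i < K, h i ≤ P.Tp
  advance : ∀ i < K, ∀ z, dist z (x i) < 5 * r i → ∀ u' ∈ P.U, dist u' (u i) < r i →
    ∀ T, 0 < T → h i - r i < T → T ≤ h i → ∃ y, P.IsMotion z [(u', T)] y ∧
      dist (y T) (x (i + 1)) < r (i + 1) ∧
      |P.runningCost [(u', T)] y - (c (i + 1) - c i)| < r (i + 1) - 5 * r i
  heur_lt : ∀ i ≤ K, ∀ z ∈ P.Xfree, dist z (x i) < r i → ∀ a, |a - c i| < r i → a + P.heur z < B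
  goal : ∀ z, dist z (x K) < r K → z ∈ P.goal ∧ ∀ a, |a - c K| < r K → a + P.term z < B

lemma AdmissibleHeuristic.le_term (h : P.AdmissibleHeuristic) {z : Pt d} (hz : z ∈ P.Xfree)
    (hg : z ∈ P.goal) : P.heur z ≤ P.term z := by
  have hm : P.IsMotion z [] (fun _ => z) :=
    ⟨rfl, continuousOn_const, fun _ _ => hz, fun t ht => by simp at ht⟩
  simpa [totalCost, runningCost] using h z [] _ .nil hm hg

lemma Link.closedBall_subset {δ : ℝ} {a b : Pt d × ℝ} (h : P.Link δ a b) :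
    Metric.closedBall a.1 δ ⊆ P.Xfree := by
  obtain ⟨-, u, hu, h, hh, -, htr⟩ := h
  obtain ⟨r, hr, H⟩ := htr 1 one_pos
  obtain ⟨y, hy, hc, -⟩ := H a.1 (by simpa using hr) u hu (by simpa using hr) h hh (by linarith)
    le_rfl
  have := hc 0 ⟨le_rfl, hh.le⟩
  rwa [hy.init] at this

/-- The cost-to-go from states close to the start of a chain into the goal bounds the heuristic. -/
lemma exists_heur_lt_of_transGen (hP : P.Standing) (hrun : P.LipschitzRunningCost)
    (hterm : P.LipschitzTerminalCost) {δ : ℝ} {a b : Pt d × ℝ}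
    (hab : Relation.TransGen (P.Link δ) a b) {δ' : ℝ} (hδ' : 0 < δ')
    (hb : Metric.closedBall b.1 δ' ⊆ P.goal) {η : ℝ} (hη : 0 < η) :
    ∃ r > 0, ∀ z, dist z a.1 < r → P.heur z < b.2 - a.2 + P.term b.1 + η := by
  obtain ⟨ρ, hρ, H⟩ := hterm.exists_close hδ' hb (half_pos hη)
  obtain ⟨r, hr, H'⟩ := exists_piecewiseConstant_of_transGen hP hrun hab (min ρ (η / 2))
    (by positivity)
  refine ⟨r, hr, fun z hz => ?_⟩
  obtain ⟨p, y, -, hp, hy, -, hyd, hyc⟩ := H' z hz (r / 2) (by positivity) (by linarith)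
  obtain ⟨hg, ht⟩ := H _ (hyd.trans_le (min_le_left _ _))
  have h1 := hP.heur_adm z p y hp.stepControl hy hg
  have h2 := hyc.trans_le (min_le_right _ _)
  rw [totalCost] at h1
  rw [abs_lt] at ht h2
  linarith [ht.2, h2.2]

/-- Every robust trajectory is the axis of corridors with cost bounds arbitrarily close to its
total cost. -/
lemma IsRobust.nonempty_corridor (hP : P.Standing) (hf : P.LipschitzDynamics)
    (hrun : P.LipschitzRunningCost) (hterm : P.LipschitzTerminalCost) {p : Segs m}
    {x : ℝ → Pt d} (hx : P.IsRobust p x) {η : ℝ} (hη : 0 < η) :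
    Nonempty (P.Corridor (P.totalCost p x + η)) := by
  obtain ⟨hsol, -, δ, hδ, hclear, hgoal⟩ := hx
  have hchain := hsol.motion.transGen hP hf hrun (δ := δ / 4) (by positivity) hsol.nonempty
    hsol.step (fun t ht => by rw [mul_div_cancel₀ _ (by norm_num : (4 : ℝ) ≠ 0)]; exact hclear t ht)
    0
  rw [zero_add] at hchain
  obtain ⟨K, hK, s, hs0, hsK, hs⟩ := hchain.exists_seq
  have hcmono : ∀ i j, i ≤ j → j ≤ K → (s i).2 ≤ (s j).2 := by
    intro i j hij
    induction j, hij using Nat.le_induction with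
    | base => exact fun _ => le_rfl
    | succ j hij ih => exact fun hj => (ih (by omega)).trans (hs j (by omega)).1
  have hterm0 : 0 ≤ P.term (x (duration p)) := hP.term_nonneg _ (hP.goal_subset hsol.reach)
  have hsK1 : (s K).1 = x (duration p) := by rw [hsK]
  have hsK2 : (s K).2 = P.runningCost p x := by rw [hsK]
  obtain ⟨ρK, hρK, HK⟩ := hterm.exists_close (z := (s K).1) hδ (by rwa [hsK1]) (half_pos hη)
  -- the radius on which the heuristic is controlled
  have hheur : ∀ i < K, ∃ ρ > 0, ∀ z, dist z (s i).1 < ρ →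
      P.heur z < (s K).2 - (s i).2 + P.term (s K).1 + η / 2 := by
    intro i hi
    exact exists_heur_lt_of_transGen hP hrun hterm (.of_seq hi hs) hδ (by rwa [hsK1]) (half_pos hη)
  have hctrl : ∀ i, ∃ u h, i < K → u ∈ P.U ∧ 0 < h ∧ h ≤ P.Tp ∧
      P.Tracks (δ / 4) u h (s i) (s (i + 1)) := by
    intro i
    by_cases hi : i < K
    · obtain ⟨-, u, h1, h, h2⟩ := hs i hi
      exact ⟨u, h, fun _ => ⟨h1, h2⟩⟩
    · exact ⟨0, 0, fun h => absurd h hi⟩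
  choose u h huh using hctrl
  obtain ⟨r, hr0, hrK, hr⟩ := exists_backward_seq (ε₀ := min ρK (η / 4)) K
    (A := fun i ε r => r ≤ η / 4 ∧ r ≤ δ / 4 ∧
      (∀ z, dist z (s i).1 < r → P.heur z < (s K).2 - (s i).2 + P.term (s K).1 + η / 2) ∧
      ∀ z, dist z (s i).1 < 5 * r → ∀ u' ∈ P.U, dist u' (u i) < r →
        ∀ T, 0 < T → h i - r < T → T ≤ h i → ∃ y, P.IsMotion z [(u', T)] y ∧
        dist (y T) (s (i + 1)).1 < ε ∧
        |P.runningCost [(u', T)] y - ((s (i + 1)).2 - (s i).2)| < ε - 5 * r) (by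
      intro i hi ε hε
      obtain ⟨ρ, hρ, H⟩ := hheur i hi
      obtain ⟨r, hr, H'⟩ := (huh i hi).2.2.2 (ε / 2) (half_pos hε)
      refine ⟨min (min (η / 4) (δ / 4)) (min ρ (min (r / 5) (ε / 10))), by positivity,
        (min_le_left _ _).trans (min_le_left _ _), (min_le_left _ _).trans (min_le_right _ _),
        fun z hz => H z (hz.trans_le ((min_le_right _ _).trans (min_le_left _ _))), ?_⟩
      set q := min (min (η / 4) (δ / 4)) (min ρ (min (r / 5) (ε / 10)))
      have hq1 : q ≤ r / 5 :=
        (min_le_right _ _).trans ((min_le_right _ _).trans (min_le_left _ _))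
      have hq2 : q ≤ ε / 10 :=
        (min_le_right _ _).trans ((min_le_right _ _).trans (min_le_right _ _))
      intro z hz u' hu' hu'' T hT hT1 hT2
      obtain ⟨y, hy, -, hyd, hyc⟩ := H' z (by linarith) u' hu' (by linarith) T hT (by linarith) hT2
      exact ⟨y, hy, by linarith, by linarith⟩)
    (by positivity)
  have hrη : ∀ i ≤ K, r i ≤ η / 4 := by
    intro i hi
    rcases hi.lt_or_eq with hi | rfl
    · exact (hr i hi).1
    · rw [hrK]; exact min_le_right _ _
  have hC : P.totalCost p x = (s K).2 + P.term (s K).1 := by rw [hsK1, hsK2, totalCost]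
  have hgoalK : ∀ z, dist z (s K).1 < r K →
      z ∈ P.goal ∧ ∀ a, |a - (s K).2| < r K → a + P.term z < P.totalCost p x + η := by
    intro z hz
    have h1 : r K ≤ ρK := by rw [hrK]; exact min_le_left _ _
    obtain ⟨hg, ht⟩ := HK z (hz.trans_le h1)
    refine ⟨hg, fun a ha => ?_⟩
    rw [abs_lt] at ha ht
    linarith [ha.2, ht.2, hrη K le_rfl]
  exact ⟨{
    K := K
    x := fun i => (s i).1
    c := fun i => (s i).2
    u := u
    h := h
    r := r
    K_pos := hK
    r_pos := hr0
    x_zero := by rw [hs0]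
    c_zero := by rw [hs0]
    c_nonneg := fun i hi => by simpa [hs0] using hcmono 0 i (by omega) hi
    le_bound := fun i hi => by
      have := hcmono i K hi le_rfl
      rw [← hsK1] at hterm0
      linarith [hrη i hi]
    ball_free := fun i hi => by
      refine Subset.trans ?_ (hs i hi).closedBall_subset
      exact Metric.ball_subset_closedBall.trans (Metric.closedBall_subset_closedBall (hr i hi).2.1)
    u_mem := fun i hi => (huh i hi).1
    h_pos := fun i hi => (huh i hi).2.1
    h_le := fun i hi => (huh i hi).2.2.1
    advance := fun i hi => (hr i hi).2.2.2
    heur_lt := fun i hi z hz hd a ha => by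
      rcases hi.lt_or_eq with hi' | rfl
      · have h1 := (hr i hi').2.2.1 z hd
        rw [abs_lt] at ha
        linarith [ha.2, hrη i hi]
      · obtain ⟨hg, ht⟩ := hgoalK z hd
        have := hP.heur_adm.le_term hz hg
        linarith [ht a ha]
    goal := hgoalK }⟩

/-! ### Invariants of the planner -/

/-- The sampled duration is positive and the sampled control is admissible; almost all samples are
valid. -/
def ValidSample (P : Problem d m) (s : Sample d m) : Prop := 0 < s.2.1 ∧ s.2.2.1 ∈ P.U

/-- The root of the tree, at the start state with cost `0`. -/
def rootNode (P : Problem d m) : Node d m := ⟨[], P.start, 0⟩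

/-- The recorded path of the vertex generates a motion from the start state to the state of the
vertex, with the recorded running cost. -/
def Reached (P : Problem d m) (y : Node d m) : Prop :=
  y.path ≠ [] ∧ P.StepControl y.path ∧ ∃ x, P.IsMotion P.start y.path x ∧
    x (duration y.path) = y.x ∧ P.runningCost y.path x = y.c

/-- The invariant of the memory of the planner. The root is treated separately, since the start
state might be in collision. -/
structure Consistent (P : Problem d m) (S : Memory d m) : Prop where
  root_mem : P.rootNode ∈ S.verts
  verts : ∀ y ∈ S.verts, y = P.rootNode ∨ P.Reached y
  sol : ∀ y, S.sol = some y → P.Reached y ∧ y.x ∈ P.goal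

lemma Reached.c_nonneg (hP : P.Standing) {y : Node d m} (h : P.Reached y) : 0 ≤ y.c := by
  obtain ⟨-, hp, x, hx, -, hc⟩ := h
  rw [← hc]
  exact hx.runningCost_nonneg hP hp

lemma Reached.exists_isSolution {y : Node d m} (h : P.Reached y) (hg : y.x ∈ P.goal) :
    ∃ x, P.IsSolution y.path x ∧ P.totalCost y.path x = y.c + P.term y.x := by
  obtain ⟨hne, hp, x, hx, hd, hc⟩ := h
  exact ⟨x, ⟨hne, hp, hx, by rwa [hd]⟩, by rw [totalCost, hd, hc]⟩

lemma Reached.extend (hP : P.Standing) (hrun : P.LipschitzRunningCost) {y : Node d m}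
    (h : y = P.rootNode ∨ P.Reached y) {u : Pt m} {τ : ℝ} (hu : u ∈ P.U) (hτ : 0 < τ)
    {x : ℝ → Pt d} (hx : P.IsMotion y.x [(u, τ)] x) :
    P.Reached ⟨y.path ++ [(u, τ)], x τ, y.c + P.runningCost [(u, τ)] x⟩ := by
  have hq : P.StepControl [(u, τ)] := .singleton hu hτ
  have hd : duration [(u, τ)] = τ := by simp
  rcases h with rfl | ⟨-, hp, z, hz, hzd, hzc⟩
  · refine ⟨by simp, by simpa [rootNode] using hq, x, by simpa [rootNode] using hx, ?_, ?_⟩ <;>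
      simp [rootNode]
  · rw [← hzd] at hx
    refine ⟨by simp, hp.append hq, _, hz.glue hp.pos hq.pos hx, ?_, ?_⟩
    · simp only
      rw [duration_append, hd, add_comm, glue_add hx.init hτ.le]
    · simp only
      rw [hz.runningCost_glue hP hrun hp hq hx, hzc]

lemma consistent_initial : P.Consistent P.initial := by
  refine ⟨by simp [initial, rootNode], ?_, by simp [initial]⟩
  intro y hy
  left
  simpa [initial, rootNode] using hy

lemma best_of_none {S : Memory d m} (h : S.sol = none) : P.best S = ⊤ := by simp [best, h]

lemma best_of_some {S : Memory d m} {y : Node d m} (h : S.sol = some y) :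
    P.best S = ((y.c + P.term y.x : ℝ) : EReal) := by simp [best, h]

/-- The possible effects of a new vertex: it is rejected, it is the new best solution, or it joins the
tree and the best solution stays. -/
lemma addNode_cases (S : Memory d m) (y : Node d m) :
    P.addNode S y = S ∨
    (y.x ∈ P.goal ∧ ((y.c + P.term y.x : ℝ) : EReal) < P.best S ∧
      P.addNode S y = ⟨{w ∈ insert y S.verts | w.c ≤ y.c + P.term y.x}, some y⟩) ∨
    P.addNode S y = ⟨insert y S.verts, S.sol⟩ := by
  unfold addNode
  split_ifs with h1 h2
  · exact .inl rfl
  · exact .inr (.inl ⟨h2.1, h2.2, rfl⟩)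
  · exact .inr (.inr rfl)

lemma best_addNode_le (S : Memory d m) (y : Node d m) : P.best (P.addNode S y) ≤ P.best S := by
  rcases addNode_cases (P := P) S y with h | ⟨-, h1, h⟩ | h <;> rw [h]
  · exact h1.le
  · rfl

lemma mem_addNode {S : Memory d m} {w : Node d m} (y : Node d m) (hw : w ∈ S.verts)
    (hc : (w.c : EReal) ≤ P.best (P.addNode S y)) : w ∈ (P.addNode S y).verts := by
  rcases addNode_cases (P := P) S y with h | ⟨-, -, h⟩ | h <;> rw [h] at hc ⊢
  · exact hw
  · exact ⟨mem_insert_of_mem _ hw, EReal.coe_le_coe_iff.1 hc⟩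
  · exact mem_insert_of_mem _ hw

lemma Consistent.addNode (hP : P.Standing) {S : Memory d m} (hS : P.Consistent S) {y : Node d m}
    (hy : P.Reached y) : P.Consistent (P.addNode S y) := by
  have hverts : ∀ w ∈ insert y S.verts, w = P.rootNode ∨ P.Reached w := by
    rintro w (rfl | hw)
    · exact .inr hy
    · exact hS.verts w hw
  rcases addNode_cases (P := P) S y with h | ⟨hg, -, h⟩ | h <;> rw [h]
  · exact hS
  · refine ⟨⟨mem_insert_of_mem _ hS.root_mem, ?_⟩, fun w hw => hverts w hw.1, ?_⟩
    · exact add_nonneg (hy.c_nonneg hP) (hP.term_nonneg _ (hP.goal_subset hg))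
    · rintro w hw
      obtain rfl : y = w := by simpa using hw
      exact ⟨hy, hg⟩
  · exact ⟨mem_insert_of_mem _ hS.root_mem, hverts, hS.sol⟩

lemma Consistent.step (hP : P.Standing) (hrun : P.LipschitzRunningCost) {S S' : Memory d m}
    (hS : P.Consistent S) {s : Sample d m} (hs : P.ValidSample s) (h : P.Step S s S') :
    P.Consistent S' := by
  obtain ⟨y, hy, ⟨x, hx, rfl⟩ | ⟨-, rfl⟩⟩ := h
  · exact hS.addNode hP (Reached.extend hP hrun (hS.verts y hy.1) hs.2 hs.1 hx)
  · exact hS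

lemma Step.best_le {S S' : Memory d m} {s : Sample d m} (h : P.Step S s S') :
    P.best S' ≤ P.best S := by
  obtain ⟨y, -, ⟨x, -, rfl⟩ | ⟨-, rfl⟩⟩ := h
  · exact best_addNode_le _ _
  · rfl

/-- Vertices that are not too expensive survive. -/
lemma Step.mem {S S' : Memory d m} {s : Sample d m} (h : P.Step S s S') {w : Node d m}
    (hw : w ∈ S.verts) (hc : (w.c : EReal) ≤ P.best S') : w ∈ S'.verts := by
  obtain ⟨y, -, ⟨x, -, rfl⟩ | ⟨-, rfl⟩⟩ := h
  · exact mem_addNode _ hw hc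
  · exact hw

/-! ### Progress along a corridor -/

lemma dist_le_augDist (x x' : Pt d) (c c' : ℝ) : dist x x' ≤ augDist x c x' c' :=
  Real.le_sqrt_of_sq_le (by nlinarith [sq_nonneg |c - c'|])

lemma abs_le_augDist (x x' : Pt d) (c c' : ℝ) : |c - c'| ≤ augDist x c x' c' :=
  Real.le_sqrt_of_sq_le (by nlinarith [sq_nonneg (dist x x')])

lemma augDist_le (x x' : Pt d) (c c' : ℝ) : augDist x c x' c' ≤ dist x x' + |c - c'| := by
  refine Real.sqrt_le_iff.2 ⟨by positivity, ?_⟩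
  nlinarith [mul_nonneg (dist_nonneg (x := x) (y := x')) (abs_nonneg (c - c'))]

namespace Corridor

variable {B : ℝ} (Q : P.Corridor B)

/-- The samples that extend a vertex near milestone `i` towards milestone `i + 1`, without the
condition on the sampled cost. -/
def box (i : ℕ) : Set (Sample d m) :=
  {s | dist s.1 (Q.x i) < Q.r i ∧ (Q.h i - Q.r i < s.2.1 ∧ s.2.1 ≤ Q.h i) ∧
    dist s.2.2.1 (Q.u i) < Q.r i}

/-- The samples that extend a vertex near milestone `i` when the best cost is `b`. Before the first
solution, the sampled cost is not used. -/
def good (i : ℕ) (b : EReal) : Set (Sample d m) :=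
  {s | s ∈ Q.box i ∧ (b = ⊤ ∨ (Q.c i < s.2.2.2 * b.toReal ∧ s.2.2.2 * b.toReal < Q.c i + Q.r i))}

/-- A vertex has a state close to milestone `i`; once there is a solution, its cost has to be close
to that of the milestone, too. -/
def Arrived (S : Memory d m) (i : ℕ) : Prop :=
  ∃ y ∈ S.verts, dist y.x (Q.x i) < Q.r i ∧ (P.best S = ⊤ ∨ |y.c - Q.c i| < Q.r i)

lemma arrived_zero {S : Memory d m} (hS : P.Consistent S) : Q.Arrived S 0 := by
  refine ⟨_, hS.root_mem, ?_, .inr ?_⟩ <;>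
  simp [rootNode, Q.x_zero, Q.c_zero, Q.r_pos]

/-- The vertex nearest to a good sample is close to the milestone. -/
lemma nearest_close {S : Memory d m} {i : ℕ} (ha : Q.Arrived S i) {s : Sample d m}
    (hs : s ∈ Q.good i (P.best S)) {y : Node d m} (hy : P.IsNearest S s.1 s.2.2.2 y) :
    dist y.x (Q.x i) < 5 * Q.r i ∧ (P.best S = ⊤ ∨ |y.c - Q.c i| < 5 * Q.r i) := by
  obtain ⟨w, hw, hwx, hwc⟩ := ha
  obtain ⟨⟨hsx, -, -⟩, hsc⟩ := hs
  have hr := Q.r_pos i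
  obtain ⟨hyv, hyn⟩ := hy
  have hsw : dist s.1 w.x < 2 * Q.r i := by
    linarith [dist_triangle_right s.1 w.x (Q.x i)]
  rcases hsol : S.sol with _ | z
  · rw [hsol] at hyn
    refine ⟨?_, .inl (best_of_none hsol)⟩
    have := hyn w hw
    linarith [dist_triangle_left y.x (Q.x i) s.1]
  · rw [hsol] at hyn
    have hb := best_of_some (P := P) hsol
    have hbt : P.best S ≠ ⊤ := by rw [hb]; exact EReal.coe_ne_top _
    have hwc' := hwc.resolve_left hbt
    obtain ⟨h1, h2⟩ := hsc.resolve_left hbt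
    rw [hb, EReal.toReal_coe] at h1 h2
    have hn := hyn w hw
    set v := s.2.2.2 * (z.c + P.term z.x)
    have h3 : |v - w.c| < 2 * Q.r i := by
      rw [abs_lt] at hwc' ⊢
      constructor <;> linarith [hwc'.1, hwc'.2]
    have h4 := augDist_le s.1 w.x v w.c
    have h5 := dist_le_augDist s.1 y.x v y.c
    have h6 := abs_le_augDist s.1 y.x v y.c
    have h7 : |v - y.c| < 4 * Q.r i := by linarith
    refine ⟨by linarith [dist_triangle_left y.x (Q.x i) s.1], .inr ?_⟩
    rw [abs_lt] at h7 ⊢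
    constructor <;> linarith [h7.1, h7.2]

/-- A good sample leads to the next milestone, unless the best cost falls to the bound of the
corridor or the first solution is found. Behind the last milestone one of these happens. -/
lemma progress (hP : P.Standing) (hf : P.LipschitzDynamics)
    {S S' : Memory d m} {s : Sample d m} (hs : P.ValidSample s) (h : P.Step S s S') {i : ℕ}
    (hi : i < Q.K) (ha : Q.Arrived S i) (hg : s ∈ Q.good i (P.best S))
    (hB : (B : EReal) < P.best S') :
    (P.best S = ⊤ ∧ P.best S' ≠ ⊤) ∨ (i + 1 < Q.K ∧ Q.Arrived S' (i + 1)) := by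
  obtain ⟨y, hy, hstep⟩ := h
  obtain ⟨hyx, hyc⟩ := Q.nearest_close ha hg hy
  obtain ⟨⟨-, ⟨hT1, hT2⟩, hu⟩, -⟩ := hg
  obtain ⟨x', hx', hx'd, hx'c⟩ := Q.advance i hi y.x hyx _ hs.2 hu _ hs.1 hT1 hT2
  rcases hstep with ⟨x, hx, rfl⟩ | ⟨hno, -⟩
  swap
  · exact absurd ⟨x', hx'⟩ hno
  -- the propagated motion is the one of the corridor
  have heq := hx.eqOn hP hf hs.2 hx'
  have hd : duration [(s.2.2.1, s.2.1)] = s.2.1 := by simp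
  have hend : x s.2.1 = x' s.2.1 := heq ⟨hs.1.le, le_rfl⟩
  have hcost : P.runningCost [(s.2.2.1, s.2.1)] x = P.runningCost [(s.2.2.1, s.2.1)] x' :=
    runningCost_congr (by rw [hd]; exact hs.1.le) (by rwa [hd])
  have hfree : x s.2.1 ∈ P.Xfree := hx.free _ (by rw [hd]; exact ⟨hs.1.le, le_rfl⟩)
  rw [← hend] at hx'd
  rw [← hcost] at hx'c
  set w : Node d m := ⟨y.path ++ [(s.2.2.1, s.2.1)], x s.2.1,
    y.c + P.runningCost [(s.2.2.1, s.2.1)] x⟩ with hw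
  have hwx : dist w.x (Q.x (i + 1)) < Q.r (i + 1) := hx'd
  have hwfree : w.x ∈ P.Xfree := hfree
  have hwc : P.best S = ⊤ ∨ |w.c - Q.c (i + 1)| < Q.r (i + 1) := by
    refine hyc.imp_right fun hyc => ?_
    simp only [hw]
    rw [abs_lt] at hyc hx'c ⊢
    constructor <;> linarith [hyc.1, hyc.2, hx'c.1, hx'c.2]
  clear_value w
  have hBS : (B : EReal) < P.best S := hB.trans_le (best_addNode_le _ _)
  -- the new vertex is not rejected
  have hacc : ¬ P.best S ≤ ((w.c + P.heur w.x : ℝ) : EReal) := by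
    rw [not_le]
    rcases hwc with htop | hwc
    · rw [htop]; exact EReal.coe_lt_top _
    · exact lt_trans (EReal.coe_lt_coe_iff.2 (Q.heur_lt (i + 1) hi _ hwfree hwx _ hwc)) hBS
  by_cases hlast : w.x ∈ P.goal ∧ ((w.c + P.term w.x : ℝ) : EReal) < P.best S
  · -- the new vertex is a better solution
    have hadd : P.addNode S w = ⟨{z ∈ insert w S.verts | z.c ≤ w.c + P.term w.x}, some w⟩ := by
      rw [addNode, if_neg hacc, if_pos hlast]
    have hbest : P.best (P.addNode S w) = ((w.c + P.term w.x : ℝ) : EReal) := by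
      rw [hadd]; rfl
    rcases hwc with htop | hwc
    · exact .inl ⟨htop, by rw [hbest]; exact EReal.coe_ne_top _⟩
    · right
      refine ⟨lt_of_le_of_ne hi ?_, w, ?_, hwx, .inr hwc⟩
      · intro hK
        rw [hK] at hwx hwc
        rw [hbest, EReal.coe_lt_coe_iff] at hB
        linarith [(Q.goal _ hwx).2 _ hwc]
      · rw [hadd]
        refine ⟨mem_insert _ _, ?_⟩
        have := hP.term_nonneg _ (hP.goal_subset hlast.1)
        linarith
  · have hadd : P.addNode S w = ⟨insert w S.verts, S.sol⟩ := by
      rw [addNode, if_neg hacc, if_neg hlast]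
    right
    refine ⟨lt_of_le_of_ne hi ?_, w, ?_, hwx, ?_⟩
    · intro hK
      rw [hK] at hwx hwc
      obtain ⟨hg, hterm⟩ := Q.goal _ hwx
      refine hlast ⟨hg, ?_⟩
      rcases hwc with htop | hwc
      · rw [htop]; exact EReal.coe_lt_top _
      · exact lt_trans (EReal.coe_lt_coe_iff.2 (hterm _ hwc)) hBS
    · rw [hadd]; exact mem_insert _ _
    · rw [hadd]; exact hwc

/-- Milestones are not lost, unless the best cost falls to the bound of the corridor or the first
solution is found. -/
lemma Arrived.step {S S' : Memory d m} {s : Sample d m} (h : P.Step S s S') {i : ℕ}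
    (hi : i < Q.K) (ha : Q.Arrived S i) (hB : (B : EReal) < P.best S')
    (htop : P.best S = ⊤ → P.best S' = ⊤) : Q.Arrived S' i := by
  obtain ⟨y, hy, hyx, hyc⟩ := ha
  rcases hyc with hyc | hyc
  · have := htop hyc
    exact ⟨y, h.mem hy (by rw [this]; exact le_top), hyx, .inl this⟩
  · refine ⟨y, h.mem hy (le_trans (EReal.coe_le_coe_iff.2 ?_) hB.le), hyx, .inr hyc⟩
    rw [abs_lt] at hyc
    linarith [Q.le_bound i hi.le, hyc.2]

/-- The milestone aimed at, if `j` is the value of the progress counter: the corridor is traversed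
first in search of a solution, counted by `0, …, K`, and then, from its beginning and with control
of the costs, in search of a good solution, counted by `K, …, 2 * K`. If the first solution comes
early, when `j < K`, the truncated subtraction selects the first milestone. -/
noncomputable def stage (b : EReal) (j : ℕ) : ℕ := if b = ⊤ then j else j - Q.K

open Classical in
/-- The update of the progress counter by a sample when the best cost is `b`. When the first
solution appears, the counter jumps to `K` at the next good sample. -/
noncomputable def next (j : ℕ) (b : EReal) (s : Sample d m) : ℕ :=
  if s ∈ Q.good (Q.stage b j) b then (if b = ⊤ then j else max j Q.K) + 1 else j

/-- The progress counter along sequences of best costs and samples. -/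
noncomputable def counter (b : ℕ → EReal) (s : ℕ → Sample d m) : ℕ → ℕ
  | 0 => 0
  | n + 1 => Q.next (counter b s n) (b n) (s n)

/-- As long as the best cost exceeds the bound of the corridor, the progress counter is bounded,
and the milestones that it announces have been reached. -/
lemma arrived_counter (hP : P.Standing) (hf : P.LipschitzDynamics)
    (hrun : P.LipschitzRunningCost) {S : ℕ → Memory d m} {s : ℕ → Sample d m}
    (h0 : S 0 = P.initial) (hs : ∀ n, P.ValidSample (s n))
    (hstep : ∀ n, P.Step (S n) (s n) (S (n + 1)))
    (n : ℕ) (hB : (B : EReal) < P.best (S n)) :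
    Q.stage (P.best (S n)) (Q.counter (fun n => P.best (S n)) s n) < Q.K ∧
      Q.Arrived (S n) (Q.stage (P.best (S n)) (Q.counter (fun n => P.best (S n)) s n)) := by
  have hcons : ∀ n, P.Consistent (S n) := by
    intro n
    induction n with
    | zero => rw [h0]; exact consistent_initial
    | succ n ih => exact ih.step hP hrun (hs n) (hstep n)
  have hK := Q.K_pos
  induction n with
  | zero =>
    have : Q.stage (P.best (S 0)) (Q.counter (fun n => P.best (S n)) s 0) = 0 := by
      simp [stage, counter]
    rw [this]
    exact ⟨hK, Q.arrived_zero (hcons 0)⟩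
  | succ n ih =>
    obtain ⟨ih1, ih2⟩ := ih (hB.trans_le (hstep n).best_le)
    set j := Q.counter (fun n => P.best (S n)) s n with hj
    have hj' : Q.counter (fun n => P.best (S n)) s (n + 1) = Q.next j (P.best (S n)) (s n) := rfl
    rw [hj']
    have hmono := (hstep n).best_le
    by_cases hb : P.best (S n) = ⊤
    · have e0 : Q.stage (P.best (S n)) j = j := by rw [stage, if_pos hb]
      by_cases hb' : P.best (S (n + 1)) = ⊤
      · by_cases hg : s n ∈ Q.good (Q.stage (P.best (S n)) j) (P.best (S n))
        · have e : Q.stage (P.best (S (n + 1))) (Q.next j (P.best (S n)) (s n)) =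
              Q.stage (P.best (S n)) j + 1 := by
            rw [next, if_pos hg, if_pos hb, e0, stage, if_pos hb']
          rw [e]
          exact (Q.progress hP hf (hs n) (hstep n) ih1 ih2 hg hB).resolve_left fun h => h.2 hb'
        · have e : Q.stage (P.best (S (n + 1))) (Q.next j (P.best (S n)) (s n)) =
              Q.stage (P.best (S n)) j := by
            rw [next, if_neg hg, e0, stage, if_pos hb']
          rw [e]
          exact ⟨ih1, Arrived.step Q (hstep n) ih1 ih2 hB fun _ => hb'⟩
      · -- the first solution has just been found
        have hj2 : Q.stage (P.best (S (n + 1))) (Q.next j (P.best (S n)) (s n)) = 0 := by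
          rw [e0] at ih1
          rw [stage, if_neg hb', next, if_pos hb]
          split_ifs <;> omega
        rw [hj2]
        exact ⟨hK, Q.arrived_zero (hcons _)⟩
    · have hb' : P.best (S (n + 1)) ≠ ⊤ := fun h => hb (top_le_iff.1 (h ▸ hmono))
      by_cases hg : s n ∈ Q.good (Q.stage (P.best (S n)) j) (P.best (S n))
      · have := (Q.progress hP hf (hs n) (hstep n) ih1 ih2 hg hB).resolve_left fun h => hb h.1
        have e : Q.stage (P.best (S (n + 1))) (Q.next j (P.best (S n)) (s n)) =
            Q.stage (P.best (S n)) j + 1 := by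
          rw [next, if_pos hg]
          simp only [stage, hb, hb', if_false]
          omega
        rw [e]
        exact this
      · have e : Q.stage (P.best (S (n + 1))) (Q.next j (P.best (S n)) (s n)) =
            Q.stage (P.best (S n)) j := by
          rw [next, if_neg hg]
          simp only [stage, hb, hb', if_false]
        rw [e]
        exact ⟨ih1, Arrived.step Q (hstep n) ih1 ih2 hB fun h => absurd h hb⟩

lemma counter_lt_of_stage_lt {b : EReal} {j : ℕ} (h : Q.stage b j < Q.K) : j < 2 * Q.K := by
  unfold stage at h
  split_ifs at h <;> omega

end Corridor

/-! ### The law of the samples -/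

lemma Standing.isProbabilityMeasure_X (hP : P.Standing) :
    IsProbabilityMeasure (cond volume P.X) :=
  cond_isProbabilityMeasure_of_finite hP.X_pos hP.X_fin

lemma Standing.isProbabilityMeasure_U (hP : P.Standing) :
    IsProbabilityMeasure (cond volume P.U) :=
  cond_isProbabilityMeasure_of_finite hP.U_pos hP.U_fin

lemma Standing.isProbabilityMeasure_T (hP : P.Standing) :
    IsProbabilityMeasure (cond volume (Ioc 0 P.Tp)) :=
  cond_isProbabilityMeasure_of_finite (by simp [hP.Tp_pos]) (by simp)

lemma isProbabilityMeasure_unit : IsProbabilityMeasure (cond (volume : Measure ℝ) (Ioo 0 1)) :=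
  cond_isProbabilityMeasure_of_finite (by simp) (by simp)

lemma Standing.isProbabilityMeasure_sampleLaw (hP : P.Standing) :
    IsProbabilityMeasure P.sampleLaw := by
  have := hP.isProbabilityMeasure_X
  have := hP.isProbabilityMeasure_U
  have := hP.isProbabilityMeasure_T
  have := isProbabilityMeasure_unit
  unfold sampleLaw
  infer_instance

lemma sampleLaw_prod (hP : P.Standing) (A : Set (Pt d)) (T : Set ℝ) (C : Set (Pt m)) (V : Set ℝ) :
    P.sampleLaw (A ×ˢ (T ×ˢ (C ×ˢ V))) = cond volume P.X A * (cond volume (Ioc 0 P.Tp) T *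
      (cond volume P.U C * cond volume (Ioo 0 1) V)) := by
  have := hP.isProbabilityMeasure_X
  have := hP.isProbabilityMeasure_U
  have := hP.isProbabilityMeasure_T
  have := isProbabilityMeasure_unit
  rw [sampleLaw, Measure.prod_prod, Measure.prod_prod, Measure.prod_prod]

lemma ae_validSample (hP : P.Standing) : ∀ᵐ s ∂P.sampleLaw, P.ValidSample s := by
  have := hP.isProbabilityMeasure_sampleLaw
  have := hP.isProbabilityMeasure_X
  have := isProbabilityMeasure_unit
  have hT : volume (Ioc 0 P.Tp) ≠ 0 := by simp [hP.Tp_pos]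
  have h1 : P.sampleLaw (univ ×ˢ (Ioc 0 P.Tp ×ˢ (P.U ×ˢ univ))) = 1 := by
    rw [sampleLaw_prod hP, cond_apply_self hT (by simp), cond_apply_self hP.U_pos hP.U_fin]
    simp
  have hm : MeasurableSet ((univ : Set (Pt d)) ×ˢ (Ioc 0 P.Tp ×ˢ (P.U ×ˢ (univ : Set ℝ)))) :=
    .prod .univ (measurableSet_Ioc.prod (hP.U_meas.prod .univ))
  have h2 := (prob_compl_eq_zero_iff hm).2 h1
  rw [← mem_ae_iff] at h2
  filter_upwards [h2] with s hs
  exact ⟨hs.2.1.1, hs.2.2.1⟩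

lemma IsRun.ae_validSample (hP : P.Standing) {Ω : Type*} [mΩ : MeasurableSpace Ω] {μ : Measure Ω}
    {ℱ : Filtration ℕ mΩ} {ξ : ℕ → Ω → Sample d m} {S : ℕ → Ω → Memory d m}
    (hS : P.IsRun μ ℱ ξ S) : ∀ᵐ ω ∂μ, ∀ n, P.ValidSample (ξ n ω) := by
  rw [ae_all_iff]
  intro n
  have h := Problem.ae_validSample hP
  rw [← hS.sample_law n] at h
  exact ae_of_ae_map ((hS.sample_meas n).mono (ℱ.le _) le_rfl).aemeasurable h

lemma exists_pos_le_of_forall_lt {g : ℕ → ENNReal} (K : ℕ) (hg : ∀ i < K, 0 < g i) :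
    ∃ γ > 0, γ ≤ 1 ∧ ∀ i < K, γ ≤ g i := by
  induction K with
  | zero => exact ⟨1, one_pos, le_rfl, by simp⟩
  | succ K ih =>
    obtain ⟨γ, h0, h1, h⟩ := ih fun i hi => hg i (by omega)
    refine ⟨min γ (g K), lt_min h0 (hg K (by omega)), (min_le_left _ _).trans h1, fun i hi => ?_⟩
    rcases (Nat.lt_succ_iff.1 hi).lt_or_eq with hi | rfl
    · exact (min_le_left _ _).trans (h i hi)
    · exact min_le_right _ _

lemma cond_pos_of_inter_pos {α : Type*} [MeasurableSpace α] {ν : Measure α} {s t : Set α}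
    (hs : MeasurableSet s) (hfin : ν s ≠ ⊤) (h : 0 < ν (s ∩ t)) : 0 < cond ν s t := by
  rw [cond_apply hs]
  exact ENNReal.mul_pos (ENNReal.inv_ne_zero.2 hfin) h.ne'

namespace Corridor

variable {B : ℝ} (Q : P.Corridor B)

/-- Good samples have a probability bounded away from zero, as long as the range of the sampled
cost is bounded. -/
lemma exists_le_sampleLaw_good (hP : P.Standing) (M : ℝ) :
    ∃ γ > 0, γ ≤ 1 ∧ ∀ i < Q.K, ∀ b : EReal, (B : EReal) < b → (b = ⊤ ∨ b ≤ (M : EReal)) →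
      γ ≤ P.sampleLaw (Q.good i b) := by
  set V : ℕ → EReal → Set ℝ := fun i b =>
    {v | b = ⊤ ∨ (Q.c i < v * b.toReal ∧ v * b.toReal < Q.c i + Q.r i)} with hV
  set q : ℕ → ENNReal := fun i => cond volume P.X (Metric.ball (Q.x i) (Q.r i)) *
    (cond volume (Ioc 0 P.Tp) (Ioc (Q.h i - Q.r i) (Q.h i)) *
      (cond volume P.U (Metric.ball (Q.u i) (Q.r i)) * min 1 (ENNReal.ofReal (Q.r i / max M 1))))
    with hq
  have hqpos : ∀ i < Q.K, 0 < q i := by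
    intro i hi
    have hr := Q.r_pos i
    refine ENNReal.mul_pos ?_ (ENNReal.mul_pos ?_ (ENNReal.mul_pos ?_ ?_).ne').ne'
    · refine (cond_pos_of_inter_pos hP.X_meas hP.X_fin ?_).ne'
      rw [inter_eq_right.2 ((Q.ball_free i hi).trans hP.free_subset)]
      exact Metric.measure_ball_pos _ _ hr
    · refine (cond_pos_of_inter_pos measurableSet_Ioc (by simp) ?_).ne'
      rw [Ioc_inter_Ioc, Real.volume_Ioc]
      have h1 := Q.h_pos i hi
      have h2 := Q.h_le i hi
      rw [min_eq_right h2]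
      simp [h1, hr]
    · refine (cond_pos_of_inter_pos hP.U_meas hP.U_fin ?_).ne'
      rw [inter_comm]
      exact hP.U_fat _ (Q.u_mem i hi) _ hr
    · refine (lt_min one_pos (ENNReal.ofReal_pos.2 ?_)).ne'
      exact div_pos hr (lt_of_lt_of_le one_pos (le_max_right _ _))
  obtain ⟨γ, h0, h1, h⟩ := exists_pos_le_of_forall_lt Q.K hqpos
  refine ⟨γ, h0, h1, fun i hi b hB hb => (h i hi).trans ?_⟩
  have hgood : Q.good i b = Metric.ball (Q.x i) (Q.r i) ×ˢ (Ioc (Q.h i - Q.r i) (Q.h i) ×ˢ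
      (Metric.ball (Q.u i) (Q.r i) ×ˢ V i b)) := by
    ext s
    simp only [good, box, mem_ofPred_eq, hV, mem_prod, Metric.mem_ball, mem_Ioc, and_assoc]
  rw [hgood, sampleLaw_prod hP]
  simp only [hq]
  gcongr
  rw [cond_apply measurableSet_Ioo]
  simp only [Real.volume_Ioo, sub_zero, ENNReal.ofReal_one, inv_one, one_mul]
  have hr := Q.r_pos i
  by_cases hbt : b = ⊤
  · have : V i b = univ := by ext v; simp [hV, hbt]
    rw [this, inter_univ]
    simp
  · have hbM := hb.resolve_left hbt
    have hbb : b ≠ ⊥ := fun h => by rw [h] at hB; exact not_lt_bot hB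
    lift b to ℝ using ⟨hbt, hbb⟩ with t ht
    rw [EReal.coe_lt_coe_iff] at hB
    rw [EReal.coe_le_coe_iff] at hbM
    have hc := Q.c_nonneg i hi.le
    have hcr := Q.le_bound i hi.le
    have ht0 : 0 < t := by linarith
    -- the interval of good cost samples has length `r i` and lies in the range `(0, t)`
    have hsub : Ioo (Q.c i / t) ((Q.c i + Q.r i) / t) ⊆ Ioo 0 1 ∩ V i t := by
      rintro v ⟨hv1, hv2⟩
      rw [div_lt_iff₀ ht0] at hv1
      rw [lt_div_iff₀ ht0] at hv2
      refine ⟨⟨?_, ?_⟩, .inr ?_⟩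
      · by_contra hcon
        nlinarith
      · by_contra hcon
        nlinarith
      · rw [EReal.toReal_coe]
        exact ⟨hv1, hv2⟩
    refine (min_le_right _ _).trans (le_trans ?_ (measure_mono hsub))
    rw [Real.volume_Ioo]
    refine ENNReal.ofReal_le_ofReal ?_
    rw [← sub_div, add_sub_cancel_left]
    exact div_le_div_of_nonneg_left hr.le ht0 (hbM.trans (le_max_left _ _))

lemma measurableSet_good (i : ℕ) :
    MeasurableSet {p : EReal × Sample d m | p.2 ∈ Q.good i p.1} := by
  have hv : Measurable fun p : EReal × Sample d m => p.2.2.2.2 * p.1.toReal :=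
    (by fun_prop : Measurable fun p : EReal × Sample d m => p.2.2.2.2).mul
      measurable_fst.ereal_toReal
  have h1 : MeasurableSet {p : EReal × Sample d m | p.1 = ⊤} :=
    measurable_fst (measurableSet_singleton _)
  have h2 : MeasurableSet {p : EReal × Sample d m | dist p.2.1 (Q.x i) < Q.r i} :=
    measurableSet_lt (by fun_prop) measurable_const
  have h3 : MeasurableSet {p : EReal × Sample d m | Q.h i - Q.r i < p.2.2.1} :=
    measurableSet_lt measurable_const (by fun_prop)
  have h4 : MeasurableSet {p : EReal × Sample d m | p.2.2.1 ≤ Q.h i} :=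
    measurableSet_le (by fun_prop) measurable_const
  have h5 : MeasurableSet {p : EReal × Sample d m | dist p.2.2.2.1 (Q.u i) < Q.r i} :=
    measurableSet_lt (by fun_prop) measurable_const
  exact (h2.inter ((h3.inter h4).inter h5)).inter (h1.union
    ((measurableSet_lt measurable_const hv).inter (measurableSet_lt hv measurable_const)))

lemma measurable_next : Measurable fun p : ℕ × EReal × Sample d m => Q.next p.1 p.2.1 p.2.2 := by
  refine measurable_from_prod_countable_right fun j => ?_
  have ht : MeasurableSet {p : EReal × Sample d m | p.1 = ⊤} :=
    measurable_fst (measurableSet_singleton _)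
  have hg : MeasurableSet {p : EReal × Sample d m | p.2 ∈ Q.good (Q.stage p.1 j) p.1} := by
    have : {p : EReal × Sample d m | p.2 ∈ Q.good (Q.stage p.1 j) p.1} =
        ({p | p.1 = ⊤} ∩ {p | p.2 ∈ Q.good j p.1}) ∪
          ({p | p.1 = ⊤}ᶜ ∩ {p | p.2 ∈ Q.good (j - Q.K) p.1}) := by
      ext p
      by_cases h : p.1 = ⊤ <;> simp [stage, h]
    rw [this]
    exact (ht.inter (Q.measurableSet_good _)).union (ht.compl.inter (Q.measurableSet_good _))
  have h1 : Measurable fun p : EReal × Sample d m => (if p.1 = ⊤ then j else max j Q.K) + 1 :=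
    (Measurable.ite ht measurable_const measurable_const).add_const 1
  exact Measurable.ite hg h1 measurable_const

lemma measurable_next_comp {Ω : Type*} {mΩ : MeasurableSpace Ω} {j : Ω → ℕ} {b : Ω → EReal}
    {s : Ω → Sample d m} (hj : Measurable j) (hb : Measurable b) (hs : Measurable s) :
    Measurable fun ω => Q.next (j ω) (b ω) (s ω) := by
  have h1 : Measurable fun ω => (j ω, b ω, s ω) := hj.prodMk (hb.prodMk hs)
  have h2 := Q.measurable_next.comp h1
  exact h2

/-- In the mean, the weight `2⁻¹ ^ j` of the progress counter `j` decreases by a factor. -/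
lemma lintegral_next_le (hP : P.Standing) {γ : ENNReal} {j : ℕ} {b : EReal}
    (hγ : γ ≤ P.sampleLaw (Q.good (Q.stage b j) b)) :
    ∫⁻ s, (2⁻¹ : ENNReal) ^ Q.next j b s ∂P.sampleLaw ≤ 2⁻¹ ^ j * (1 - γ / 2) := by
  have := hP.isProbabilityMeasure_sampleLaw
  set G := Q.good (Q.stage b j) b with hG
  have hGm : MeasurableSet G := measurable_prodMk_left (x := b) (Q.measurableSet_good _)
  set g := P.sampleLaw G
  have hg1 : g ≤ 1 := prob_le_one
  have hpt : ∀ s, (2⁻¹ : ENNReal) ^ Q.next j b s ≤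
      2⁻¹ ^ j * (Gᶜ.indicator 1 s + G.indicator (fun _ => 2⁻¹) s) := by
    intro s
    by_cases hs : s ∈ G
    · have h1 : j + 1 ≤ Q.next j b s := by
        rw [next, if_pos hs]
        split_ifs
        · exact le_rfl
        · have := le_max_left j Q.K; omega
      simp only [hs, indicator_of_mem, mem_compl_iff, not_true, not_false_eq_true,
        indicator_of_notMem, zero_add]
      rw [← pow_succ]
      exact pow_le_pow_of_le_one (by simp) (by simp) h1
    · have h1 : Q.next j b s = j := by rw [next, if_neg hs]
      simp [hs, h1]
  calc ∫⁻ s, (2⁻¹ : ENNReal) ^ Q.next j b s ∂P.sampleLaw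
      ≤ ∫⁻ s, 2⁻¹ ^ j * (Gᶜ.indicator 1 s + G.indicator (fun _ => 2⁻¹) s) ∂P.sampleLaw :=
        lintegral_mono hpt
    _ = 2⁻¹ ^ j * ((1 - g) + 2⁻¹ * g) := by
        rw [lintegral_const_mul' _ _ (by simp), lintegral_add_left
          (measurable_one.indicator hGm.compl), lintegral_indicator_one hGm.compl,
          lintegral_indicator_const hGm, prob_compl_eq_one_sub hGm]
    _ ≤ 2⁻¹ ^ j * (1 - γ / 2) := by
        gcongr
        refine le_trans ?_ (tsub_le_tsub_left (ENNReal.div_le_div_right hγ 2) 1)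
        refine ENNReal.le_sub_of_add_le_right (by
          exact ENNReal.div_ne_top (ne_top_of_le_ne_top ENNReal.one_ne_top hg1) (by simp)) ?_
        rw [mul_comm, ← div_eq_mul_inv, add_assoc, ENNReal.add_halves, tsub_add_cancel_of_le hg1]

end Corridor

/-! ### Exponential decay -/

section Run

variable {Ω : Type*} [mΩ : MeasurableSpace Ω] {μ : Measure Ω}
  {ℱ : Filtration ℕ mΩ} {ξ : ℕ → Ω → Sample d m} {S : ℕ → Ω → Memory d m}

/-- A sample is integrated out, conditionally on the past. -/
lemma IsRun.lintegral_eq [IsProbabilityMeasure μ] (hS : P.IsRun μ ℱ ξ S) (hP : P.Standing) (n : ℕ) {E : Type*}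
    [MeasurableSpace E] {Y : Ω → E} (hY : Measurable[ℱ n] Y) {F : E × Sample d m → ENNReal}
    (hF : Measurable F) :
    ∫⁻ ω, F (Y ω, ξ n ω) ∂μ = ∫⁻ ω, ∫⁻ s, F (Y ω, s) ∂P.sampleLaw ∂μ := by
  have := hP.isProbabilityMeasure_sampleLaw
  have hξ : Measurable (ξ n) := (hS.sample_meas n).mono (ℱ.le _) le_rfl
  have hY' : Measurable Y := hY.mono (ℱ.le _) le_rfl
  have hind : IndepFun Y (ξ n) μ := by
    rw [IndepFun_iff_Indep]
    exact indep_of_indep_of_le_left (hS.sample_indep n) hY.comap_le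
  rw [indepFun_iff_map_prod_eq_prod_map_map hY'.aemeasurable hξ.aemeasurable,
    hS.sample_law n] at hind
  rw [← lintegral_map hF (hY'.prodMk hξ), hind, lintegral_prod _ hF.aemeasurable,
    lintegral_map hF.lintegral_prod_right' hY']

/-- The event that after `n` iterations the best cost still exceeds `B`, where all the best costs
found so far are at most `M`. -/
def unsolved (P : Problem d m) (S : ℕ → Ω → Memory d m) (B M : ℝ) (n : ℕ) : Set Ω :=
  {ω | (B : EReal) < P.best (S n ω) ∧
    ∀ k ≤ n, P.best (S k ω) = ⊤ ∨ P.best (S k ω) ≤ (M : EReal)}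

lemma IsRun.measurableSet_unsolved (hS : P.IsRun μ ℱ ξ S) (B M : ℝ) (n : ℕ) :
    MeasurableSet[ℱ n] (P.unsolved S B M n) := by
  have hb := hS.best_meas
  have h1 : MeasurableSet[ℱ n] {ω | (B : EReal) < P.best (S n ω)} := hb n measurableSet_Ioi
  have h2 : MeasurableSet[ℱ n] (⋂ k, ⋂ _ : k ≤ n,
      {ω | P.best (S k ω) = ⊤ ∨ P.best (S k ω) ≤ (M : EReal)}) := by
    refine MeasurableSet.iInter fun k => MeasurableSet.iInter fun hk => ?_
    have : MeasurableSet[ℱ k] {ω | P.best (S k ω) = ⊤ ∨ P.best (S k ω) ≤ (M : EReal)} :=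
      hb k ((measurableSet_singleton ⊤).union measurableSet_Iic)
    exact ℱ.mono hk _ this
  have e : P.unsolved S B M n = {ω | (B : EReal) < P.best (S n ω)} ∩ ⋂ k, ⋂ _ : k ≤ n,
      {ω | P.best (S k ω) = ⊤ ∨ P.best (S k ω) ≤ (M : EReal)} := by
    ext ω
    simp [unsolved]
  rw [e]
  exact h1.inter h2

lemma IsRun.measurable_counter (hS : P.IsRun μ ℱ ξ S) {B : ℝ} (Q : P.Corridor B) (n : ℕ) :
    Measurable[ℱ n] fun ω => Q.counter (fun n => P.best (S n ω)) (fun n => ξ n ω) n := by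
  induction n with
  | zero => exact measurable_const
  | succ n ih =>
    have h1 : ℱ n ≤ ℱ (n + 1) := ℱ.mono n.le_succ
    exact Q.measurable_next_comp (mΩ := ℱ (n + 1)) (ih.mono h1 le_rfl)
      ((hS.best_meas n).mono h1 le_rfl) (hS.sample_meas n)

/-- The counter argument: the expected weight `2⁻¹ ^ j` of the progress counter on the event
`unsolved` decays exponentially, while the counter is bounded there. -/
lemma IsRun.measure_unsolved_le [IsProbabilityMeasure μ] (hS : P.IsRun μ ℱ ξ S) (hP : P.Standing)
    (hf : P.LipschitzDynamics) (hrun : P.LipschitzRunningCost) {B : ℝ} (Q : P.Corridor B) (M : ℝ) :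
    ∃ γ > 0, γ ≤ 1 ∧ ∀ n, μ (P.unsolved S B M n) ≤ 2 ^ (2 * Q.K) * (1 - γ / 2) ^ n := by
  obtain ⟨γ, hγ0, hγ1, hγ⟩ := Q.exists_le_sampleLaw_good hP M
  refine ⟨γ, hγ0, hγ1, ?_⟩
  set J : ℕ → Ω → ℕ := fun n ω => Q.counter (fun n => P.best (S n ω)) (fun n => ξ n ω) n with hJ
  have harr : ∀ᵐ ω ∂μ, ∀ n, ω ∈ P.unsolved S B M n → Q.stage (P.best (S n ω)) (J n ω) < Q.K := by
    filter_upwards [hS.ae_validSample hP] with ω hω n hn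
    exact (Q.arrived_counter hP hf hrun (hS.init ω) hω (fun n => hS.step n ω) n hn.1).1
  have hanti : ∀ n, P.unsolved S B M (n + 1) ⊆ P.unsolved S B M n := fun n ω h =>
    ⟨h.1.trans_le (hS.step n ω).best_le, fun k hk => h.2 k (by omega)⟩
  -- the weight, as a function of the counter and the indicator of `unsolved`
  set w : ℕ → Ω → ENNReal := fun n => (P.unsolved S B M n).indicator fun _ => 1 with hw
  have hwm : ∀ n, Measurable[ℱ n] (w n) := fun n =>
    measurable_const.indicator (hS.measurableSet_unsolved B M n)
  have hdecay : ∀ n, ∫⁻ ω, w n ω * 2⁻¹ ^ J n ω ∂μ ≤ (1 - γ / 2) ^ n := by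
    intro n
    induction n with
    | zero =>
      rw [pow_zero]
      calc ∫⁻ ω, w 0 ω * 2⁻¹ ^ J 0 ω ∂μ ≤ ∫⁻ _, 1 ∂μ := by
            refine lintegral_mono fun ω => ?_
            have h1 : w 0 ω ≤ 1 := indicator_le_self' (by simp) ω
            have h2 : (2⁻¹ : ENNReal) ^ J 0 ω ≤ 1 := pow_le_one₀ (by simp) (by simp)
            exact mul_le_one' h1 h2
        _ = 1 := by simp
    | succ n ih =>
      have hYm : Measurable[ℱ n] fun ω => (w n ω, J n ω, P.best (S n ω)) :=
        Measurable.prodMk (m := ℱ n) (hwm n)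
          (Measurable.prodMk (m := ℱ n) (hS.measurable_counter Q n) (hS.best_meas n))
      have hFm : Measurable fun q : (ENNReal × ℕ × EReal) × Sample d m =>
          q.1.1 * (2⁻¹ : ENNReal) ^ Q.next q.1.2.1 q.1.2.2 q.2 := by
        refine (measurable_fst.comp measurable_fst).mul ?_
        have h1 : Measurable fun q : (ENNReal × ℕ × EReal) × Sample d m =>
            Q.next q.1.2.1 q.1.2.2 q.2 :=
          Q.measurable_next_comp (by fun_prop) (by fun_prop) (by fun_prop)
        exact (measurable_of_countable fun k : ℕ => (2⁻¹ : ENNReal) ^ k).comp h1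
      have hint := hS.lintegral_eq hP n hYm hFm
      simp only at hint
      calc ∫⁻ ω, w (n + 1) ω * 2⁻¹ ^ J (n + 1) ω ∂μ
          ≤ ∫⁻ ω, w n ω * 2⁻¹ ^ Q.next (J n ω) (P.best (S n ω)) (ξ n ω) ∂μ := by
            refine lintegral_mono fun ω => ?_
            have : w (n + 1) ω ≤ w n ω :=
              indicator_le_indicator_of_subset (hanti n) (fun _ => zero_le_one) ω
            exact mul_le_mul_left this _
        _ = ∫⁻ ω, ∫⁻ s, w n ω * 2⁻¹ ^ Q.next (J n ω) (P.best (S n ω)) s ∂P.sampleLaw ∂μ :=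
            hint
        _ ≤ ∫⁻ ω, w n ω * 2⁻¹ ^ J n ω * (1 - γ / 2) ∂μ := by
            refine lintegral_mono_ae ?_
            filter_upwards [harr] with ω hω
            by_cases hmem : ω ∈ P.unsolved S B M n
            · have hw1 : w n ω = 1 := by simp [hw, hmem]
              simp only [hw1, one_mul]
              exact Q.lintegral_next_le hP
                (hγ _ (hω n hmem) _ hmem.1 (hmem.2 n le_rfl))
            · have hw0 : w n ω = 0 := by simp [hw, hmem]
              simp [hw0]
        _ = (∫⁻ ω, w n ω * 2⁻¹ ^ J n ω ∂μ) * (1 - γ / 2) :=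
            lintegral_mul_const' _ _ (ne_top_of_le_ne_top ENNReal.one_ne_top tsub_le_self)
        _ ≤ (1 - γ / 2) ^ (n + 1) := by
            rw [pow_succ]; gcongr
  intro n
  have hm : MeasurableSet (P.unsolved S B M n) := ℱ.le n _ (hS.measurableSet_unsolved B M n)
  calc μ (P.unsolved S B M n) = ∫⁻ ω, w n ω ∂μ := (lintegral_indicator_one hm).symm
    _ ≤ ∫⁻ ω, 2 ^ (2 * Q.K) * (w n ω * 2⁻¹ ^ J n ω) ∂μ := by
        refine lintegral_mono_ae ?_
        filter_upwards [harr] with ω hω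
        by_cases hmem : ω ∈ P.unsolved S B M n
        · have hw1 : w n ω = 1 := by simp [hw, hmem]
          have hj := Q.counter_lt_of_stage_lt (hω n hmem)
          rw [hw1, one_mul]
          calc (1 : ENNReal) = 2 ^ (2 * Q.K) * 2⁻¹ ^ (2 * Q.K) := by
                rw [← mul_pow, ENNReal.mul_inv_cancel (by simp) (by simp), one_pow]
            _ ≤ 2 ^ (2 * Q.K) * 2⁻¹ ^ J n ω := by
                gcongr 2 ^ (2 * Q.K) * ?_
                exact pow_le_pow_of_le_one (by simp) (by simp) hj.le
        · have hw0 : w n ω = 0 := by simp [hw, hmem]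
          simp [hw0]
    _ = 2 ^ (2 * Q.K) * ∫⁻ ω, w n ω * 2⁻¹ ^ J n ω ∂μ :=
        lintegral_const_mul' _ _ (by simp)
    _ ≤ 2 ^ (2 * Q.K) * (1 - γ / 2) ^ n := by gcongr; exact hdecay n

lemma IsRun.exists_exp_bound [IsProbabilityMeasure μ] (hS : P.IsRun μ ℱ ξ S) (hP : P.Standing)
    (hf : P.LipschitzDynamics) (hrun : P.LipschitzRunningCost) {B : ℝ} (Q : P.Corridor B) (M : ℝ) :
    ∃ a > (0 : ℝ), ∃ b > (0 : ℝ), ∀ n : ℕ,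
      μ.real (P.unsolved S B M n) ≤ a * Real.exp (-b * n) := by
  obtain ⟨γ, hγ0, hγ1, h⟩ := hS.measure_unsolved_le hP hf hrun Q M
  set ρ : ENNReal := 1 - γ / 2 with hρ
  have hρ1 : ρ < 1 := ENNReal.sub_lt_self (by simp) (by simp)
    (ENNReal.div_pos hγ0.ne' (by simp)).ne'
  have hρ0 : 0 < ρ := by
    refine tsub_pos_of_lt ((ENNReal.div_le_div_right hγ1 2).trans_lt ?_)
    rw [one_div]
    exact ENNReal.inv_lt_one.2 (by norm_num)
  have hρt : ρ ≠ ⊤ := (hρ1.trans ENNReal.one_lt_top).ne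
  have hq0 : 0 < ρ.toReal := ENNReal.toReal_pos hρ0.ne' hρt
  have hq1 : ρ.toReal < 1 := by
    rw [← ENNReal.toReal_one]
    exact (ENNReal.toReal_lt_toReal hρt (by simp)).2 hρ1
  refine ⟨2 ^ (2 * Q.K), by positivity, -Real.log ρ.toReal, ?_, fun n => ?_⟩
  · have := Real.log_neg hq0 hq1
    linarith
  · have h1 : Real.exp (- -Real.log ρ.toReal * n) = ρ.toReal ^ n := by
      rw [neg_neg, mul_comm, Real.exp_nat_mul, Real.exp_log hq0]
    rw [h1, Measure.real]
    refine (ENNReal.toReal_mono ?_ (h n)).trans (le_of_eq ?_)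
    · exact ENNReal.mul_ne_top (by simp) (ENNReal.pow_ne_top hρt)
    · simp

end Run

/-! ### Approximation of solutions by robust ones -/

lemma bddBelow_robust_costs (hP : P.Standing) :
    BddBelow {c : ℝ | ∃ p x, P.IsRobust p x ∧ P.totalCost p x = c} := by
  refine ⟨0, ?_⟩
  rintro c ⟨p, x, h, rfl⟩
  exact h.1.totalCost_nonneg hP

lemma IsRobust.cStar_le (hP : P.Standing) {p : Segs m} {x : ℝ → Pt d} (h : P.IsRobust p x) :
    P.cStar ≤ P.totalCost p x :=
  csInf_le (bddBelow_robust_costs hP) ⟨p, x, h, rfl⟩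

/-- If the collision-free region and the goal are open, then every solution is the limit of robust
ones: it has some clearance, and its durations are replaced by slightly smaller multiples of a small
`τ`. -/
lemma IsSolution.exists_isRobust (hP : P.Standing) (hf : P.LipschitzDynamics)
    (hrun : P.LipschitzRunningCost) (hterm : P.LipschitzTerminalCost) (hfree : IsOpen P.Xfree)
    (hgoal : IsOpen P.goal) {p : Segs m} {x : ℝ → Pt d} (h : P.IsSolution p x) {η : ℝ}
    (hη : 0 < η) : ∃ p' x', P.IsRobust p' x' ∧ P.totalCost p' x' < P.totalCost p x + η := by
  have hcomp : IsCompact (x '' Icc 0 (duration p)) := isCompact_Icc.image_of_continuousOn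
    h.motion.cont
  obtain ⟨δ, hδ, hδs⟩ := hcomp.exists_cthickening_subset_open hfree
    (by rintro _ ⟨t, ht, rfl⟩; exact h.motion.free t ht)
  have hclear : ∀ t ∈ Icc 0 (duration p), Metric.closedBall (x t) (4 * (δ / 4)) ⊆ P.Xfree := by
    intro t ht
    rw [mul_div_cancel₀ _ (by norm_num : (4 : ℝ) ≠ 0)]
    exact (Metric.closedBall_subset_cthickening (mem_image_of_mem x ht) δ).trans hδs
  obtain ⟨δ', hδ', hδ's⟩ := Metric.nhds_basis_closedBall.mem_iff.1 (hgoal.mem_nhds h.reach)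
  obtain ⟨ρ, hρ, Hρ⟩ := hterm.exists_close hδ' hδ's (half_pos hη)
  have hchain := h.motion.transGen hP hf hrun (δ := δ / 4) (by positivity) h.nonempty h.step
    hclear 0
  obtain ⟨r, hr, H⟩ := exists_piecewiseConstant_of_transGen hP hrun hchain
    (min (min ρ (η / 2)) (δ' / 2)) (by positivity)
  obtain ⟨q, y, hq0, hq, hy, hyc, hyd, hycost⟩ := H P.start (by simpa using hr) (r / 2)
    (by positivity) (by linarith)
  simp only [zero_add, sub_zero] at hyd hycost
  have h1 := hyd.trans_le ((min_le_left _ _).trans (min_le_left _ _))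
  have h2 := hycost.trans_le ((min_le_left _ _).trans (min_le_right _ _))
  have h3 := hyd.trans_le (min_le_right _ _)
  obtain ⟨hg, ht⟩ := Hρ _ h1
  refine ⟨q, y, ⟨⟨hq0, hq.stepControl, hy, hg⟩, ⟨_, hq⟩, min (δ / 4) (δ' / 2), by positivity,
    fun t ht => ?_, ?_⟩, ?_⟩
  · exact (Metric.closedBall_subset_closedBall (min_le_left _ _)).trans (hyc t ht)
  · refine Subset.trans (Metric.closedBall_subset_closedBall' ?_) hδ's
    linarith [min_le_right (δ / 4) (δ' / 2)]
  · rw [abs_lt] at ht h2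
    simp only [totalCost]
    linarith [ht.2, h2.2]

lemma IsSolution.cStar_le_of_isOpen (hP : P.Standing) (hf : P.LipschitzDynamics)
    (hrun : P.LipschitzRunningCost) (hterm : P.LipschitzTerminalCost) (hfree : IsOpen P.Xfree)
    (hgoal : IsOpen P.goal) {p : Segs m} {x : ℝ → Pt d} (h : P.IsSolution p x) :
    P.cStar ≤ P.totalCost p x := by
  refine le_of_forall_pos_le_add fun η hη => ?_
  obtain ⟨p', x', hr, hlt⟩ := h.exists_isRobust hP hf hrun hterm hfree hgoal hη
  exact (hr.cStar_le hP).trans hlt.le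

/-! ### Runs of the planner -/

section Run

variable {Ω : Type*} [mΩ : MeasurableSpace Ω] {μ : Measure Ω}
  {ℱ : Filtration ℕ mΩ} {ξ : ℕ → Ω → Sample d m} {S : ℕ → Ω → Memory d m}

lemma IsRun.antitone_best (hS : P.IsRun μ ℱ ξ S) (ω : Ω) : Antitone fun n => P.best (S n ω) :=
  antitone_nat_of_succ_le fun n => (hS.step n ω).best_le

lemma IsRun.ae_isSolution (hS : P.IsRun μ ℱ ξ S) (hP : P.Standing)
    (hrun : P.LipschitzRunningCost) :
    ∀ᵐ ω ∂μ, ∀ (n : ℕ) (y : Node d m), (S n ω).sol = some y →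
      ∃ x : ℝ → Pt d, P.IsSolution y.path x ∧
        P.best (S n ω) = ((P.totalCost y.path x : ℝ) : EReal) := by
  filter_upwards [hS.ae_validSample hP] with ω hω n y hy
  have hcons : P.Consistent (S n ω) := by
    clear hy
    induction n with
    | zero => rw [hS.init]; exact consistent_initial
    | succ n ih => exact ih.step hP hrun (hω n) (hS.step n ω)
  obtain ⟨hr, hg⟩ := hcons.sol y hy
  obtain ⟨x, hx, hc⟩ := hr.exists_isSolution hg
  exact ⟨x, hx, by rw [best_of_some hy, hc]⟩

lemma IsRun.ae_best (hS : P.IsRun μ ℱ ξ S) (hP : P.Standing) (hrun : P.LipschitzRunningCost) :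
    ∀ᵐ ω ∂μ, ∀ n, P.best (S n ω) = ⊤ ∨
      ∃ p x, P.IsSolution p x ∧ P.best (S n ω) = ((P.totalCost p x : ℝ) : EReal) := by
  filter_upwards [hS.ae_isSolution hP hrun] with ω hω n
  rcases h : (S n ω).sol with _ | y
  · exact .inl (best_of_none h)
  · obtain ⟨x, hx, hc⟩ := hω n y h
    exact .inr ⟨_, x, hx, hc⟩

/-- Almost surely the best cost falls below every bound which is the bound of a corridor. Costs
need not be bounded: after the first solution they are bounded by its cost. -/
lemma IsRun.ae_exists_best_le [IsProbabilityMeasure μ] (hS : P.IsRun μ ℱ ξ S) (hP : P.Standing)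
    (hf : P.LipschitzDynamics) (hrun : P.LipschitzRunningCost) {B : ℝ} (Q : P.Corridor B) :
    ∀ᵐ ω ∂μ, ∃ n, P.best (S n ω) ≤ (B : EReal) := by
  have hnull : ∀ M : ℕ, ∀ᵐ ω ∂μ, ∃ n, ω ∉ P.unsolved S B M n := by
    intro M
    obtain ⟨a, -, b, hb, h⟩ := hS.exists_exp_bound hP hf hrun Q M
    have hlim : Tendsto (fun n : ℕ => a * Real.exp (-b * n)) atTop (𝓝 0) := by
      have h1 : Tendsto (fun n : ℕ => b * (n : ℝ)) atTop atTop :=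
        tendsto_natCast_atTop_atTop.const_mul_atTop hb
      have h2 := (Real.tendsto_exp_neg_atTop_nhds_zero.comp h1).const_mul a
      simpa [Function.comp_def] using h2
    have hzero : μ.real (⋂ n, P.unsolved S B M n) = 0 := by
      refine le_antisymm (ge_of_tendsto' hlim fun n => ?_) measureReal_nonneg
      exact (measureReal_mono (iInter_subset _ n)).trans (h n)
    rw [measureReal_eq_zero_iff] at hzero
    rw [ae_iff]
    convert hzero using 2
    ext ω
    simp
  rw [← ae_all_iff] at hnull
  filter_upwards [hnull] with ω hω
  by_contra! hcon
  -- the best costs of this run are all infinite or at most `M`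
  obtain ⟨M, hM⟩ : ∃ M : ℕ, ∀ k, P.best (S k ω) = ⊤ ∨ P.best (S k ω) ≤ ((M : ℝ) : EReal) := by
    by_cases hall : ∀ k, P.best (S k ω) = ⊤
    · exact ⟨0, fun k => .inl (hall k)⟩
    · classical
      push Not at hall
      set k₀ := Nat.find hall
      have hk₀ : P.best (S k₀ ω) ≠ ⊤ := Nat.find_spec hall
      obtain ⟨M, hM⟩ := exists_nat_ge (P.best (S k₀ ω)).toReal
      refine ⟨M, fun k => ?_⟩
      rcases lt_or_ge k k₀ with hk | hk
      · exact .inl (not_not.1 (Nat.find_min hall hk))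
      · refine .inr ((hS.antitone_best ω hk).trans ((EReal.le_coe_toReal hk₀).trans ?_))
        exact EReal.coe_le_coe_iff.2 hM
  obtain ⟨n, hn⟩ := hω M
  exact hn ⟨hcon n, fun k _ => hM k⟩

lemma IsRun.ae_eventually_best_le [IsProbabilityMeasure μ] (hS : P.IsRun μ ℱ ξ S)
    (hP : P.Standing) (hf : P.LipschitzDynamics) (hrun : P.LipschitzRunningCost)
    (hterm : P.LipschitzTerminalCost) (hne : ∃ p x, P.IsRobust p x) :
    ∀ᵐ ω ∂μ, ∀ η > (0 : ℝ), ∀ᶠ n in atTop, P.best (S n ω) ≤ ((P.cStar + η : ℝ) : EReal) := by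
  have hk : ∀ k : ℕ, ∀ᵐ ω ∂μ, ∃ n, P.best (S n ω) ≤ ((P.cStar + 1 / (k + 1) : ℝ) : EReal) := by
    intro k
    have hpos : (0 : ℝ) < 1 / (k + 1) / 2 := by positivity
    obtain ⟨p₀, x₀, h₀⟩ := hne
    obtain ⟨_, ⟨p, x, hpx, rfl⟩, hlt⟩ := exists_lt_of_csInf_lt
      (s := {c : ℝ | ∃ p x, P.IsRobust p x ∧ P.totalCost p x = c}) ⟨_, p₀, x₀, h₀, rfl⟩
      (show P.cStar < P.cStar + 1 / (k + 1) / 2 by linarith)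
    obtain ⟨Q⟩ := hpx.nonempty_corridor hP hf hrun hterm hpos
    filter_upwards [hS.ae_exists_best_le hP hf hrun Q] with ω ⟨n, hn⟩
    exact ⟨n, hn.trans (EReal.coe_le_coe_iff.2 (by linarith))⟩
  rw [← ae_all_iff] at hk
  filter_upwards [hk] with ω hω η hη
  obtain ⟨k, hk⟩ := exists_nat_one_div_lt hη
  obtain ⟨n, hn⟩ := hω k
  filter_upwards [eventually_ge_atTop n] with i hi
  exact (hS.antitone_best ω hi).trans (hn.trans (EReal.coe_le_coe_iff.2 (by linarith)))

end Run

end Problem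

end KiTe

theorem theorem1 {d m : ℕ} (P : KiTe.Problem d m) (hP : P.Standing)
    (hf : P.LipschitzDynamics) (hrun : P.LipschitzRunningCost) (hterm : P.LipschitzTerminalCost)
    {Ω : Type*} [mΩ : MeasurableSpace Ω] (μ : Measure Ω) [IsProbabilityMeasure μ]
    (ℱ : Filtration ℕ mΩ) (ξ : ℕ → Ω → KiTe.Sample d m) (S : ℕ → Ω → KiTe.Memory d m)
    (hS : P.IsRun μ ℱ ξ S) :
    -- the best cost is the total cost of the solution trajectory that is returned
    (∀ᵐ ω ∂μ, ∀ (n : ℕ) (y : KiTe.Node d m), (S n ω).sol = some y →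
      ∃ x : ℝ → KiTe.Pt d, P.IsSolution y.path x ∧
        P.best (S n ω) = ((P.totalCost y.path x : ℝ) : EReal)) ∧
    -- exponential bound, as long as the sampled cost ranges `(0, c_best)` lie in `(0, M)`
    (∀ (p : KiTe.Segs m) (x : ℝ → KiTe.Pt d), P.IsRobust p x → 0 < P.totalCost p x →
      ∀ ε ∈ Ioo (0 : ℝ) 1, ∀ M : ℝ, ∃ a > (0 : ℝ), ∃ b > (0 : ℝ), ∃ n₀ : ℕ, ∀ n > n₀,
        μ.real {ω | (((1 + ε) * P.totalCost p x : ℝ) : EReal) < P.best (S n ω) ∧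
          ∀ k ≤ n, P.best (S k ω) = ⊤ ∨ P.best (S k ω) ≤ (M : EReal)} ≤
            a * Real.exp (-b * n)) ∧
    -- exponential bound, if the total costs of all solutions are bounded
    ((∃ M : ℝ, ∀ p x, P.IsSolution p x → P.totalCost p x ≤ M) →
      ∀ (p : KiTe.Segs m) (x : ℝ → KiTe.Pt d), P.IsRobust p x → 0 < P.totalCost p x →
      ∀ ε ∈ Ioo (0 : ℝ) 1, ∃ a > (0 : ℝ), ∃ b > (0 : ℝ), ∃ n₀ : ℕ, ∀ n > n₀,
        μ.real {ω | (((1 + ε) * P.totalCost p x : ℝ) : EReal) < P.best (S n ω)} ≤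
          a * Real.exp (-b * n)) ∧
    -- asymptotic optimality
    ((∃ p x, P.IsRobust p x) →
      (∀ᵐ ω ∂μ, ∀ η > (0 : ℝ), ∀ᶠ n in atTop, P.best (S n ω) ≤ ((P.cStar + η : ℝ) : EReal)) ∧
      (((IsOpen P.Xfree ∧ IsOpen P.goal) ∨ ∀ p x, P.IsSolution p x → P.cStar ≤ P.totalCost p x) →
        ∀ᵐ ω ∂μ, Tendsto (fun n => P.best (S n ω)) atTop (𝓝 ((P.cStar : ℝ) : EReal)))) := by
  have hbound : ∀ (p : KiTe.Segs m) (x : ℝ → KiTe.Pt d), P.IsRobust p x → 0 < P.totalCost p x →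
      ∀ ε ∈ Ioo (0 : ℝ) 1, ∀ M : ℝ, ∃ a > (0 : ℝ), ∃ b > (0 : ℝ), ∀ n : ℕ,
        μ.real (P.unsolved S ((1 + ε) * P.totalCost p x) M n) ≤ a * Real.exp (-b * n) := by
    intro p x hpx hpos ε hε M
    obtain ⟨Q⟩ := hpx.nonempty_corridor hP hf hrun hterm (mul_pos hε.1 hpos)
    rw [show P.totalCost p x + ε * P.totalCost p x = (1 + ε) * P.totalCost p x by ring] at Q
    exact hS.exists_exp_bound hP hf hrun Q M
  refine ⟨hS.ae_isSolution hP hrun, ?_, ?_, fun hne => ?_⟩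
  · intro p x hpx hpos ε hε M
    obtain ⟨a, ha, b, hb, h⟩ := hbound p x hpx hpos ε hε M
    exact ⟨a, ha, b, hb, 0, fun n _ => h n⟩
  · rintro ⟨M, hM⟩ p x hpx hpos ε hε
    obtain ⟨a, ha, b, hb, h⟩ := hbound p x hpx hpos ε hε M
    refine ⟨a, ha, b, hb, 0, fun n _ => le_trans ?_ (h n)⟩
    refine ENNReal.toReal_mono (measure_ne_top _ _) (measure_mono_ae ?_)
    filter_upwards [hS.ae_best hP hrun] with ω hω hlt
    refine ⟨hlt, fun k _ => (hω k).imp_right ?_⟩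
    rintro ⟨q, y, hq, hc⟩
    rw [hc]
    exact EReal.coe_le_coe_iff.2 (hM q y hq)
  · have hev := hS.ae_eventually_best_le hP hf hrun hterm hne
    refine ⟨hev, fun hlow => ?_⟩
    have hle : ∀ p x, P.IsSolution p x → P.cStar ≤ P.totalCost p x := by
      rcases hlow with ⟨hfree, hgoal⟩ | hlow
      · exact fun p x h => h.cStar_le_of_isOpen hP hf hrun hterm hfree hgoal
      · exact hlow
    filter_upwards [hev, hS.ae_best hP hrun] with ω h1 h2
    have h3 : ∀ n, ((P.cStar : ℝ) : EReal) ≤ P.best (S n ω) := by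
      intro n
      rcases h2 n with h | ⟨q, y, hq, hc⟩
      · rw [h]; exact le_top
      · rw [hc]; exact EReal.coe_le_coe_iff.2 (hle q y hq)
    refine tendsto_order.2 ⟨fun b hb => .of_forall fun n => hb.trans_le (h3 n), fun b hb => ?_⟩
    obtain ⟨c, hc1, hc2⟩ := EReal.lt_iff_exists_real_btwn.1 hb
    rw [EReal.coe_lt_coe_iff] at hc1
    filter_upwards [h1 (c - P.cStar) (by linarith)] with n hn
    rw [add_sub_cancel] at hn
    exact hn.trans_lt hc2
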